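/- **Setting.** Let $(\Omega,\mathcal A,\mu)$ be a measure space and $X$ a real Banach space with dual $X^*$. An *atom* is a set $A\in\mathcal A$ with $\mu(A)>0$ such that every measurable $B\subset A$ has $\mu(B)\in\{0,\mu(A)\}$. Let $\mathcal A_{a\sigma}$ be the system of countable unions of atoms and sets of finite measure. A property holds *integrally a.e.* (i.a.e.) if it holds a.e. on every $A\in\mathcal A_{a\sigma}$. A function is *integrally* (strongly, weak\*, $\mathcal A_\mu$-) *measurable* if its restriction to every $A\in\mathcal A_{a\sigma}$ is so; here $\mathcal A_\mu$ is the $\mu$-completion of $\mathcal A$. An integrand $f\colon\Omega\times X\to[-\infty,\infty]$ is *integrally separably measurable* if for every $A\in\mathcal A_{a\sigma}$ and every separable $W\subset X$ its restriction to $A\times W$ is measurable for the product of the trace $\sigma$-algebra and $\mathcal B(W)$. For a family $\alpha=(\alpha_A)_{A\in\mathcal A_{a\sigma}}$ of $\mathcal A_\mu$-measurable functions $\alpha_A\colon A\to[-\infty,\infty]$ with $\alpha_A=\alpha_B$ a.e. on $A\cap B$ put $\int\alpha^\pm\,d\mu=\sup_{A\in\mathcal A_{a\sigma}}\int_A\alpha_A^\pm\,d\mu$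 and $\int\alpha\,d\mu=\int\alpha^+\,d\mu-\int\alpha^-\,d\mu$ if one of the two is finite, $\int\alpha\,d\mu=+\infty$ otherwise. An integrally measurable function is integrated as the family of its restrictions. If $\mu$ is $\sigma$-finite, then $\Omega\in\mathcal A_{a\sigma}$, the word "integrally" may be dropped, and this is the extended Lebesgue integral with $\infty-\infty=+\infty$. A set $R$ of functions $\Omega\to X$ is *almost decomposable* if for all $u_0\in R$, measurable $F$ with $\mu(F)<\infty$, $\varepsilon>0$ and bounded strongly measurable $u_1\colon F\to X$ there is a measurable $F_\varepsilon\subset F$ with $\mu(F\setminus F_\varepsilon)<\varepsilon$ such that the function equal to $u_1$ on $F_\varepsilon$ and to $u_0$ on $\Omega\setminus F_\varepsilon$ belongs to $R$. Let $R$ be an almost decomposable linear space of integrally strongly measurable functions $u\colon\Omega\to X$ and $S$ a linear space of integrally weak\* measurable functions $\Omega\to X^*$ such that $\langle u,v\rangle:=\int\langle v(\omega),u(\omega)\rangle\,d\mu(\omega)$ is a real number for all $u\in R$, $v\in S$. Let $f$ be an integrally separably measurable integrand, $I_f(u)=\int f(\omega,u(\omega))\,d\mu(\omega)$ for $u\in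 R$, and $I_f\not\equiv\infty$ on $R$. For $W\subset X$ let $f_W$ be the restriction of $f$ to $\Omega\times W$ and $$f_W^*(\omega,\xi)=\sup_{x\in W}\,\langle\xi,x\rangle-f(\omega,x),\qquad f^*=f_X^*,\qquad I_f^*(v)=\sup_{u\in R}\,\langle u,v\rangle-I_f(u).$$ For $u\in R$ with $I_f(u)\in\mathbb R$ let $\partial I_f(u)=\{v\in S: I_f(w)\ge I_f(u)+\langle w-u,v\rangle\ \forall w\in R\}$, and for $x_0\in W$ with $f(\omega,x_0)\in\mathbb R$ let $\partial f_W(\omega,x_0)=\{\xi\in X^*: f(\omega,x)\ge f(\omega,x_0)+\langle\xi,x-x_0\rangle\ \forall x\in W\}$ (both are empty if the value in question is not real). **Theorem.** Let $v\in S$ be such that for every atom $A$ with $\mu(A)=\infty$ and every separable $W\subset X$ one has $f_W^*(\omega,v(\omega))\le0$ for a.e. $\omega\in A$. 1. For every $A\in\mathcal A_{a\sigma}$ the family $f_W^*(\cdot,v(\cdot))$, $W\subset X$ separable, has an essential supremum function on $A$, and with the integral of the resulting family $$I_f^*(v)=\int\operatorname*{ess\,sup}_{W\subset X\text{ separable}}\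 \sup_{x\in W}\,\langle v(\omega),x\rangle-f(\omega,x)\ d\bar\mu(\omega).$$ 2. Let $u\in R$ with $I_f(u)\in\mathbb R$. Then $v\in\partial I_f(u)$ if and only if, for every $A\in\mathcal A_{a\sigma}$ and every separable $W\subset X$ with $u(\omega)\in W$ for a.e. $\omega\in A$, one has $v(\omega)\in\partial f_W(\omega,u(\omega))$ for a.e. $\omega\in A$. Let $\mathcal S_u(X)$ be the system of separable $W\subset X$ with $u(\omega)\in W$ i.a.e. If $\mathcal S_u(X)\neq\emptyset$ (for instance, if $u$ is strongly measurable or $\mu$ is $\sigma$-finite), then $$v\in\partial I_f(u)\iff v\in\bigcap_{W\in\mathcal S_u(X)}\{v'\in S: v'(\omega)\in\partial f_W(\omega,u(\omega))\ \text{i.a.e.}\}.$$ 3. Let $I_f^*(v)<\infty$. The following two are equivalent: (i) $\omega\mapsto f^*(\omega,v(\omega))$ is integrally $\mathcal A_\mu$-measurable and $I_f^*(v)=I_{f^*}(v):=\int f^*(\omega,v(\omega))\,d\bar\mu(\omega)$; (ii) for every $A\in\mathcal A_{a\sigma}$ there is a separable $W\subset X$ with $f^*(\omega,v(\omega))=f^*_W(\omega,v(\omega))$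 for a.e. $\omega\in A$. If $\mathcal S_u(X)\neq\emptyset$ for every $u\in R$ (for instance, if all members of $R$ are strongly measurable or $\mu$ is $\sigma$-finite), then (i) is also equivalent to (iii) there is one separable $W\subset X$ with $f^*(\omega,v(\omega))=f_W^*(\omega,v(\omega))$ i.a.e. If (i) or (ii) holds, then for every $u\in R$ with $I_f(u)\in\mathbb R$ one has $v\in\partial I_f(u)$ if and only if $v(\omega)\in\partial f_X(\omega,u(\omega))$ i.a.e. -/

import Mathlib

open MeasureTheory Set

noncomputable section

namespace ConvexIntegral

section MeasureTheoreticPart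

/-- An atom of `μ`: a measurable set of positive measure such that each of its measurable subsets
is either null or has the same measure. -/
def IsMeasureAtom {Ω : Type*} [MeasurableSpace Ω] (μ : Measure Ω) (A : Set Ω) : Prop :=
  MeasurableSet A ∧ μ A ≠ 0 ∧ ∀ B : Set Ω, MeasurableSet B → B ⊆ A → μ B = 0 ∨ μ B = μ A

/-- Countable unions of atoms and of (`σ`-)finite sets. -/
def IsAtomSigmaFinite {Ω : Type*} [MeasurableSpace Ω] (μ : Measure Ω) (A : Set Ω) : Prop :=
  ∃ B : ℕ → Set Ω,
    (∀ n, MeasurableSet (B n) ∧ (μ (B n) < ⊤ ∨ IsMeasureAtom μ (B n))) ∧ A = ⋃ n, B n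

/-- A property holds integrally almost everywhere if it holds almost everywhere on every atom and
on every set of `σ`-finite measure. -/
def IntegrallyAE {Ω : Type*} [MeasurableSpace Ω] (μ : Measure Ω) (p : Ω → Prop) : Prop :=
  ∀ A : Set Ω, IsAtomSigmaFinite μ A → ∀ᵐ ω ∂(μ.restrict A), p ω

/-- Integral measurability of an extended real function with respect to the completion of `μ`. -/
def IntegrallyAEMeasurable {Ω : Type*} [MeasurableSpace Ω] (μ : Measure Ω)
    (α : Ω → EReal) : Prop :=
  ∀ A : Set Ω, IsAtomSigmaFinite μ A → AEMeasurable α (μ.restrict A)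

/-- Exhausting integral of the positive part of a family `α A`, where `A` ranges over the countable
unions of atoms and `σ`-finite sets. -/
def exhPos {Ω : Type*} [MeasurableSpace Ω] (μ : Measure Ω) (α : Set Ω → Ω → EReal) : ENNReal :=
  ⨆ (A : Set Ω) (_ : IsAtomSigmaFinite μ A), ∫⁻ ω in A, (α A ω).toENNReal ∂μ

open Classical in
/-- Exhausting integral of a family `α A`. It is the difference of the integrals of the positive and
of the negative part if one of them is finite, and `⊤` if both are infinite. -/
def exhIntegralFamily {Ω : Type*} [MeasurableSpace Ω] (μ : Measure Ω)
    (α : Set Ω → Ω → EReal) : EReal :=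
  if exhPos μ α = ⊤ then ⊤
  else (exhPos μ α : EReal) - (exhPos μ (fun A ω => -α A ω) : EReal)

/-- Exhausting integral of a single function. -/
def exhIntegral {Ω : Type*} [MeasurableSpace Ω] (μ : Measure Ω) (α : Ω → EReal) : EReal :=
  exhIntegralFamily μ (fun _ => α)

/-- `α` is an essential supremum function with respect to `ν` of the family `g i`. -/
def IsEssSup {Ω ι : Type*} [MeasurableSpace Ω] (ν : Measure Ω) (g : ι → Ω → EReal)
    (α : Ω → EReal) : Prop :=
  AEMeasurable α ν ∧ (∀ i, ∀ᵐ ω ∂ν, g i ω ≤ α ω) ∧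
    ∀ β : Ω → EReal, AEMeasurable β ν → (∀ i, ∀ᵐ ω ∂ν, g i ω ≤ β ω) → ∀ᵐ ω ∂ν, α ω ≤ β ω

/-- Strong measurability on every atom and every `σ`-finite set. -/
def IntegrallyStronglyMeasurable {Ω X : Type*} [MeasurableSpace Ω] [TopologicalSpace X]
    (μ : Measure Ω) (u : Ω → X) : Prop :=
  ∀ A : Set Ω, IsAtomSigmaFinite μ A → StronglyMeasurable (fun ω : A => u ω)

/-- Weak* measurability on every atom and every `σ`-finite set. -/
def IntegrallyWeakStarMeasurable {Ω X : Type*} [MeasurableSpace Ω] [NormedAddCommGroup X]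
    [NormedSpace ℝ X] (μ : Measure Ω) (v : Ω → StrongDual ℝ X) : Prop :=
  ∀ A : Set Ω, IsAtomSigmaFinite μ A → ∀ x : X, Measurable (fun ω : A => v ω x)

/-- On every atom and every `σ`-finite set, the restriction of the integrand to any separable `W`
in its second variable is measurable for the product of the trace `σ`-algebra and `B(W)`. -/
def IntegrallySeparablyMeasurable {Ω X : Type*} [MeasurableSpace Ω] [TopologicalSpace X]
    [MeasurableSpace X] (μ : Measure Ω) (f : Ω → X → EReal) : Prop :=
  ∀ A : Set Ω, IsAtomSigmaFinite μ A → ∀ W : Set X, TopologicalSpace.IsSeparable W →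
    Measurable (fun p : A × W => f p.1 p.2)

open Classical in
/-- Almost decomposability of a space of functions with respect to `μ`. -/
def AlmostDecomposable {Ω X : Type*} [MeasurableSpace Ω] [NormedAddCommGroup X]
    (μ : Measure Ω) (R : Set (Ω → X)) : Prop :=
  ∀ u₀ ∈ R, ∀ F : Set Ω, MeasurableSet F → μ F < ⊤ → ∀ ε : ENNReal, 0 < ε →
    ∀ u₁ : Ω → X, StronglyMeasurable u₁ → (∃ C : ℝ, ∀ ω ∈ F, ‖u₁ ω‖ ≤ C) →
      ∃ G : Set Ω, MeasurableSet G ∧ G ⊆ F ∧ μ (F \ G) < ε ∧ G.piecewise u₁ u₀ ∈ R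

end MeasureTheoreticPart

section ConvexPart

/-- `sup_{x ∈ W} ⟨ξ, x⟩ - h x`, the conjugate of the restriction of `h` to `W`. -/
def conjOn {X : Type*} [NormedAddCommGroup X] [NormedSpace ℝ X] (h : X → EReal) (W : Set X)
    (ξ : StrongDual ℝ X) : EReal :=
  ⨆ x ∈ W, ((ξ x : ℝ) : EReal) - h x

/-- `ξ`, restricted to `W`, is a subgradient at `x₀ ∈ W` of the restriction of `h` to `W`. -/
def IsSubgradientOn {X : Type*} [NormedAddCommGroup X] [NormedSpace ℝ X] (h : X → EReal)
    (W : Set X) (x₀ : X) (ξ : StrongDual ℝ X) : Prop :=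
  x₀ ∈ W ∧ h x₀ ≠ ⊥ ∧ h x₀ ≠ ⊤ ∧ ∀ x ∈ W, h x₀ + ((ξ (x - x₀) : ℝ) : EReal) ≤ h x

/-- The pairing `∫ ⟨v(ω), u(ω)⟩ dμ(ω)`. -/
def pairing {Ω X : Type*} [MeasurableSpace Ω] [NormedAddCommGroup X] [NormedSpace ℝ X]
    (μ : Measure Ω) (u : Ω → X) (v : Ω → StrongDual ℝ X) : EReal :=
  exhIntegral μ (fun ω => ((v ω (u ω) : ℝ) : EReal))

/-- The integral functional `I_f(u) = ∫ f(ω, u(ω)) dμ(ω)`. -/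
def integralFunctional {Ω X : Type*} [MeasurableSpace Ω] (μ : Measure Ω) (f : Ω → X → EReal)
    (u : Ω → X) : EReal :=
  exhIntegral μ (fun ω => f ω (u ω))

/-- The convex conjugate of `I_f` on `R` with respect to the pairing. -/
def integralConjugate {Ω X : Type*} [MeasurableSpace Ω] [NormedAddCommGroup X] [NormedSpace ℝ X]
    (μ : Measure Ω) (R : Set (Ω → X)) (f : Ω → X → EReal) (v : Ω → StrongDual ℝ X) : EReal :=
  ⨆ u ∈ R, pairing μ u v - integralFunctional μ f u

/-- The Fenchel-Moreau subdifferential of `I_f` on `R` at `u`, a subset of `S`. -/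
def integralSubdifferential {Ω X : Type*} [MeasurableSpace Ω] [NormedAddCommGroup X]
    [NormedSpace ℝ X] (μ : Measure Ω) (R : Set (Ω → X)) (S : Set (Ω → StrongDual ℝ X))
    (f : Ω → X → EReal) (u : Ω → X) : Set (Ω → StrongDual ℝ X) :=
  {v | v ∈ S ∧ integralFunctional μ f u ≠ ⊥ ∧ integralFunctional μ f u ≠ ⊤ ∧
    ∀ w ∈ R, integralFunctional μ f u + pairing μ (w - u) v ≤ integralFunctional μ f w}

/-- The system of separable sets almost containing the range of `u`. -/
def sepAlmostRange {Ω X : Type*} [MeasurableSpace Ω] [TopologicalSpace X] (μ : Measure Ω)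
    (u : Ω → X) : Set (Set X) :=
  {W | TopologicalSpace.IsSeparable W ∧ IntegrallyAE μ (fun ω => u ω ∈ W)}

/-- `ω ↦ f*(ω, v(ω))` is integrally measurable for the completion of `μ` and the conjugate of the
integral functional at `v` is the integral functional of the conjugate. -/
def ConjugateUnderIntegral {Ω X : Type*} [MeasurableSpace Ω] [NormedAddCommGroup X]
    [NormedSpace ℝ X] (μ : Measure Ω) (R : Set (Ω → X)) (f : Ω → X → EReal)
    (v : Ω → StrongDual ℝ X) : Prop :=
  IntegrallyAEMeasurable μ (fun ω => conjOn (f ω) univ (v ω)) ∧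
    integralConjugate μ R f v = exhIntegral μ (fun ω => conjOn (f ω) univ (v ω))

/-- One separable set suffices, integrally almost everywhere, to compute `f*(ω, v(ω))`. -/
def DualizableIAE {Ω X : Type*} [MeasurableSpace Ω] [NormedAddCommGroup X]
    [NormedSpace ℝ X] (μ : Measure Ω) (f : Ω → X → EReal) (v : Ω → StrongDual ℝ X) : Prop :=
  ∃ W : Set X, TopologicalSpace.IsSeparable W ∧
    IntegrallyAE μ (fun ω => conjOn (f ω) univ (v ω) = conjOn (f ω) W (v ω))

/-- On each countable union of atoms and `σ`-finite sets, one separable set suffices almost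
everywhere to compute `f*(ω, v(ω))`. -/
def IntegrallyDualizable {Ω X : Type*} [MeasurableSpace Ω] [NormedAddCommGroup X]
    [NormedSpace ℝ X] (μ : Measure Ω) (f : Ω → X → EReal) (v : Ω → StrongDual ℝ X) : Prop :=
  ∀ A : Set Ω, IsAtomSigmaFinite μ A → ∃ W : Set X, TopologicalSpace.IsSeparable W ∧
    ∀ᵐ ω ∂(μ.restrict A), conjOn (f ω) univ (v ω) = conjOn (f ω) W (v ω)

end ConvexPart

end ConvexIntegral

end

/-!
The proof compares everything with the functions `fenchelTerm f v w = ⟨v, w⟩ - f(·, w)` for strongly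
measurable `w`, whose suprema are the conjugates in question.

Let `A` be a countable union of atoms and sets of finite measure. On an atom of infinite measure a
function with finite integral vanishes, hence `⟨v, u⟩ - f(·, u)` vanishes there whenever
`I_f(u) < ∞`, and so does the essential supremum of the restricted conjugates, by the sign
assumption on them. The remaining part of `A` is `σ`-finite. There the family of all
`⟨v, w⟩ - f(·, w)` is directed, since two functions `w` can be glued, and it contains an increasing
sequence whose limit `α` dominates the family almost everywhere (`exists_monotone_seq_ae_le_iSup`).
The function `α` also dominates the conjugate of the restriction of `f` to any separable set:
otherwise, measurable selection (`exists_measurable_selection`) provides a strongly measurable `w`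
with `⟨v, w⟩ - f(·, w) > α` on a set of positive measure. So `α` is the essential supremum, and it
is attained at a single separable set, which contains the ranges of the sequence
(`IsPaired.exists_approximation`). The selection theorem is proved from Mathlib's analytic sets: a
measurable subset of a product depends on countably many measurable sets of the first factor only,
which reduces the claim to Polish spaces; there a capacitability argument and the parametrization of
compact sets by the Cantor set give a section.

The exhausting integral is additive in spite of the suprema in its definition, since the index
system is directed. Hence it suffices, for the formula for the conjugate, to approximate the
integral of `α - (⟨v, u⟩ - f(·, u))` by members of `R`, where `I_f(u)` is finite.
Almost decomposability does this: `u` is replaced, on a set of finite measure, by a bounded piece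
of a function `w` that nearly attains `α` (`IsPaired.exists_mem_lt_exhPos_sub`).

The subdifferential is characterized by equality in the Fenchel-Young inequality, so by
`∫ (α - (⟨v, u⟩ - f(·, u))) = 0`, which is a pointwise condition. Similarly, `α ≤ f*(·, v)` always
holds, and interchange of conjugation and integration with a finite value means
`∫ (f*(·, v) - α) = 0`, that is, `f*(·, v)` is the conjugate on a single separable set. That set can
be chosen independently of `A` if `u` has an almost separable range, because a function with finite
exhausting integral lives on one `A`.
-/

namespace ConvexIntegral

/-! ### Measurable selection on a set of positive measure -/

/-- Every measurable subset of a product is the preimage of a measurable set under a map that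
factors the first coordinate through the Cantor space: it only depends on countably many
measurable sets of the first factor. -/
theorem exists_preimage_cantor_of_measurableSet_prod {Ω Y : Type*} [MeasurableSpace Ω]
    [MeasurableSpace Y] {M : Set (Ω × Y)} (hM : MeasurableSet M) :
    ∃ φ : Ω → ℕ → Bool, Measurable φ ∧ ∃ M' : Set ((ℕ → Bool) × Y), MeasurableSet M' ∧
      M = (fun p : Ω × Y => (φ p.1, p.2)) ⁻¹' M' := by
  classical
  rw [← generateFrom_prod] at hM
  induction M, hM using MeasurableSpace.generateFrom_induction with
  | hC t ht _ =>
    obtain ⟨a, ha, b, hb, rfl⟩ := ht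
    refine ⟨fun ω _ => decide (ω ∈ a), ?_, {p | p.1 0 = true ∧ p.2 ∈ b}, ?_, ?_⟩
    · refine measurable_pi_lambda _ fun _ => ?_
      exact measurable_to_bool (by simpa [preimage] using ha)
    · have h0 : MeasurableSet {c : ℕ → Bool | c 0 = true} :=
        measurableSet_eq_fun (measurable_pi_apply 0) measurable_const
      exact (measurable_fst h0).inter (measurable_snd hb)
    · ext ⟨x, y⟩
      simp
  | empty => exact ⟨fun _ _ => true, measurable_const, ∅, MeasurableSet.empty, by simp⟩
  | compl t _ ih =>
    obtain ⟨φ, hφ, M', hM', rfl⟩ := ih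
    exact ⟨φ, hφ, M'ᶜ, hM'.compl, rfl⟩
  | iUnion s _ ih =>
    choose φ hφ M' hM' hs using ih
    refine ⟨fun ω k => φ k.unpair.1 ω k.unpair.2, ?_,
      ⋃ n, (fun p : (ℕ → Bool) × Y => (fun k => p.1 (Nat.pair n k), p.2)) ⁻¹' M' n, ?_, ?_⟩
    · exact measurable_pi_lambda _ fun k => (measurable_pi_apply _).comp (hφ _)
    · refine MeasurableSet.iUnion fun n => ?_
      refine Measurable.prodMk (measurable_pi_lambda _ fun k => ?_) measurable_snd (hM' n)
      exact (measurable_pi_apply _).comp measurable_fst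
    · rw [preimage_iUnion]
      refine iUnion_congr fun n => ?_
      rw [hs n]
      ext ⟨x, y⟩
      simp

/-- A capacitability argument: a continuous image of the Baire space of positive outer measure
contains the image of a compact set, which also has positive measure. -/
theorem exists_isCompact_measure_image_ne_zero {C : Type*} [TopologicalSpace C]
    [TopologicalSpace.MetrizableSpace C] [MeasurableSpace C] [BorelSpace C] (ν : Measure C)
    [IsFiniteMeasure ν] {h : (ℕ → ℕ) → C} (hh : Continuous h) (hν : ν (range h) ≠ 0) :
    ∃ K : Set (ℕ → ℕ), IsCompact K ∧ ν (h '' K) ≠ 0 := by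
  let := TopologicalSpace.metrizableSpaceMetric C
  obtain ⟨a, ha0, ha⟩ := exists_between (pos_iff_ne_zero.2 hν)
  have step : ∀ (k : ℕ) (s : {s : Set (ℕ → ℕ) // a < ν (h '' s)}),
      ∃ n : ℕ, a < ν (h '' (s.1 ∩ {x | x k ≤ n})) := by
    intro k s
    have hU : h '' s.1 = ⋃ n, h '' (s.1 ∩ {x | x k ≤ n}) := by
      rw [← image_iUnion, ← inter_iUnion]
      congr 1
      refine (inter_eq_left.2 fun x _ => mem_iUnion.2 ⟨x k, le_refl (x k)⟩).symm
    have hmono : Monotone fun n => h '' (s.1 ∩ {x | x k ≤ n}) := fun n n' hn =>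
      image_mono (inter_subset_inter_right _ fun x hx => le_trans hx hn)
    have := s.2
    rw [hU, hmono.measure_iUnion] at this
    exact lt_iSup_iff.1 this
  choose n hn using step
  let S : ℕ → {s : Set (ℕ → ℕ) // a < ν (h '' s)} := fun k =>
    Nat.rec ⟨univ, by rwa [image_univ]⟩ (fun k s => ⟨s.1 ∩ {x | x k ≤ n k s}, hn k s⟩) k
  let m : ℕ → ℕ := fun k => n k (S k)
  have hS : ∀ k, (S k).1 = {x | ∀ i < k, x i ≤ m i} := by
    intro k
    induction k with
    | zero => simp [S]
    | succ k ih =>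
      have : (S (k + 1)).1 = (S k).1 ∩ {x | x k ≤ m k} := rfl
      rw [this, ih]
      ext x
      simp only [mem_inter_iff, mem_ofPred_eq, Nat.lt_succ_iff_lt_or_eq]
      exact ⟨fun hx i hi => hi.elim (hx.1 i) fun e => e ▸ hx.2,
        fun hx => ⟨fun i hi => hx i (.inl hi), hx k (.inr rfl)⟩⟩
  let K : Set (ℕ → ℕ) := univ.pi fun i => Iic (m i)
  have hK : IsCompact K := isCompact_univ_pi fun i => (finite_Iic (m i)).isCompact
  refine ⟨K, hK, fun h0 => ?_⟩
  obtain ⟨U, hKU, hUo, hUa⟩ := (h '' K).exists_isOpen_lt_of_lt (μ := ν) a (by rwa [h0])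
  -- Some `S k` is contained in `h ⁻¹' U`: a sequence of counterexamples would accumulate in `K`.
  have key : ∃ k, (S k).1 ⊆ h ⁻¹' U := by
    by_contra! hcon
    choose x hxS hxU using fun k => not_subset.1 (hcon k)
    have hyK : ∀ k, (x k ⊓ m) ∈ K := fun k i _ => mem_Iic.2 inf_le_right
    obtain ⟨y, hy, θ, hθ, hlim⟩ := hK.tendsto_subseq hyK
    have hlim' : Filter.Tendsto (fun j => x (θ j)) Filter.atTop (nhds y) := by
      rw [tendsto_pi_nhds] at hlim ⊢
      intro i
      refine (hlim i).congr' ?_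
      filter_upwards [Filter.eventually_gt_atTop i] with j hj
      have h1 := hxS (θ j)
      rw [hS] at h1
      exact inf_eq_left.2 (h1 i (hj.trans_le (hθ.id_le j)))
    have hyU : y ∈ h ⁻¹' U := hKU ⟨y, hy, rfl⟩
    obtain ⟨j, hj⟩ := (hlim'.eventually ((hUo.preimage hh).mem_nhds hyU)).exists
    exact hxU _ hj
  obtain ⟨k, hk⟩ := key
  exact absurd ((S k).2.trans_le (measure_mono (image_subset_iff.2 hk))) hUa.not_gt

/-- A continuous map on a compact set of reals has a measurable section on its range: take the
largest point of each fibre. -/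
theorem exists_measurable_section_of_isCompact_real {C : Type*} [TopologicalSpace C] [T2Space C]
    [MeasurableSpace C] [BorelSpace C] {Q : Set ℝ} (hQ : IsCompact Q) (hne : Q.Nonempty)
    {p : Q → C} (hp : Continuous p) :
    ∃ s : C → Q, Measurable s ∧ ∀ c ∈ range p, p (s c) = c := by
  classical
  obtain ⟨t₀, ht₀⟩ := hne
  have : CompactSpace Q := isCompact_iff_compactSpace.1 hQ
  let fib : C → Set ℝ := fun c => Subtype.val '' (p ⁻¹' {c})
  have hfibc : ∀ c, IsCompact (fib c) := fun c =>
    ((isClosed_singleton.preimage hp).isCompact).image continuous_subtype_val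
  have hfibQ : ∀ c, fib c ⊆ Q := by
    rintro c _ ⟨t, -, rfl⟩
    exact t.2
  have hfibne : ∀ c ∈ range p, (fib c).Nonempty := by
    rintro _ ⟨t, rfl⟩
    exact ⟨t, t, rfl, rfl⟩
  have hmem : ∀ c ∈ range p, sSup (fib c) ∈ fib c := fun c hc => (hfibc c).sSup_mem (hfibne c hc)
  let s₀ : C → ℝ := fun c => if c ∈ range p then sSup (fib c) else t₀
  have hs₀Q : ∀ c, s₀ c ∈ Q := by
    intro c
    by_cases hc : c ∈ range p
    · simp only [s₀, if_pos hc]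
      exact hfibQ c (hmem c hc)
    · simpa only [s₀, if_neg hc] using ht₀
  have hrange : MeasurableSet (range p) := (isCompact_range hp).isClosed.measurableSet
  have hs₀ : Measurable s₀ := by
    refine measurable_of_Ici fun a => ?_
    have hset : s₀ ⁻¹' Ici a =
        p '' {t | a ≤ t.1} ∪ ((range p)ᶜ ∩ {_c | a ≤ t₀}) := by
      ext c
      by_cases hc : c ∈ range p
      · simp only [s₀, mem_preimage, mem_Ici, mem_union, mem_inter_iff, mem_compl_iff,
          not_true_eq_false, false_and, or_false, hc]
        constructor
        · intro h
          obtain ⟨t, ht, hts⟩ := hmem c hc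
          exact ⟨t, by simpa [hts] using h, ht⟩
        · rintro ⟨t, ht, htc⟩
          exact le_trans ht (le_csSup (hfibc c).bddAbove ⟨t, htc, rfl⟩)
      · simp only [s₀, mem_preimage, mem_Ici, mem_union, mem_inter_iff, mem_compl_iff,
          not_false_eq_true, true_and, hc, mem_ofPred_eq]
        refine ⟨Or.inr, fun h => h.resolve_left ?_⟩
        rintro ⟨t, -, rfl⟩
        exact hc ⟨t, rfl⟩
    rw [hset]
    refine MeasurableSet.union ?_ (hrange.compl.inter (MeasurableSet.const _))
    have : IsCompact {t : Q | a ≤ t.1} :=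
      (isClosed_le continuous_const continuous_subtype_val).isCompact
    exact (this.image hp).isClosed.measurableSet
  refine ⟨fun c => ⟨s₀ c, hs₀Q c⟩, hs₀.subtype_mk, fun c hc => ?_⟩
  obtain ⟨t, ht, hts⟩ := hmem c hc
  have : (⟨s₀ c, hs₀Q c⟩ : Q) = t := Subtype.ext (by simp only [s₀, if_pos hc, hts])
  change p ⟨s₀ c, hs₀Q c⟩ = c
  rw [this]
  exact ht

/-- Measurable selection: a measurable subset of `Ω × Y`, with `Y` Polish, whose projection to `Ω`
has positive outer measure contains the graph of a measurable map over a set of positive measure. -/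
theorem exists_measurable_selection {Ω Y : Type*} [MeasurableSpace Ω] [TopologicalSpace Y]
    [PolishSpace Y] [MeasurableSpace Y] [BorelSpace Y] (ν : Measure Ω) [IsFiniteMeasure ν]
    {M : Set (Ω × Y)} (hM : MeasurableSet M) (h0 : ν (Prod.fst '' M) ≠ 0) :
    ∃ s : Ω → Y, Measurable s ∧ ν {ω | (ω, s ω) ∈ M} ≠ 0 := by
  obtain ⟨φ, hφ, M', hM', rfl⟩ := exists_preimage_cantor_of_measurableSet_prod hM
  have hproj : Prod.fst '' ((fun p : Ω × Y => (φ p.1, p.2)) ⁻¹' M') ⊆ φ ⁻¹' (Prod.fst '' M') := by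
    rintro _ ⟨⟨ω, y⟩, h, rfl⟩
    exact ⟨_, h, rfl⟩
  have hν' : ν.map φ (Prod.fst '' M') ≠ 0 := fun h =>
    h0 (measure_mono_null hproj
      (nonpos_iff_eq_zero.1 ((Measure.le_map_apply hφ.aemeasurable _).trans h.le)))
  have hM'ne : M' ≠ ∅ := by
    rintro rfl
    simp at hν'
  have hcantor : PolishSpace (ℕ → Bool) :=
    (isClosed_cantorSet.isClosedEmbedding_subtypeVal.comp
      cantorSetHomeomorphNatToBool.symm.isClosedEmbedding).polishSpace
  have hM'a := hM'.analyticSet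
  rw [AnalyticSet] at hM'a
  obtain ⟨g, hg, hgM⟩ := hM'a.resolve_left hM'ne
  have hp : Continuous fun x => (g x).1 := continuous_fst.comp hg
  have hrange : Prod.fst '' M' = range fun x => (g x).1 := by
    rw [← hgM, ← range_comp]
    rfl
  rw [hrange] at hν'
  obtain ⟨K, hK, hKν⟩ := exists_isCompact_measure_image_ne_zero (ν.map φ) hp hν'
  have hKne : K.Nonempty := by
    rw [nonempty_iff_ne_empty]
    rintro rfl
    simp at hKν
  -- The compact set `K` is parametrized by the Cantor set, which is a compact set of reals.
  let : MetricSpace K := TopologicalSpace.metrizableSpaceMetric K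
  have : CompactSpace K := isCompact_iff_compactSpace.1 hK
  have : Nonempty K := hKne.to_subtype
  obtain ⟨e, he, hesurj⟩ := exists_nat_bool_continuous_surjective_of_compact K
  let e' : cantorSet → (ℕ → ℕ) := fun t => (e (cantorSetHomeomorphNatToBool t)).1
  have he' : Continuous e' :=
    continuous_subtype_val.comp (he.comp cantorSetHomeomorphNatToBool.continuous)
  obtain ⟨s, hs, hsec⟩ := exists_measurable_section_of_isCompact_real isCompact_cantorSet
    ⟨0, zero_mem_cantorSet⟩ (hp.comp he')
  refine ⟨fun ω => (g (e' (s (φ ω)))).2,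
    (continuous_snd.comp (hg.comp he')).measurable.comp (hs.comp hφ), fun hz => ?_⟩
  refine hKν ?_
  rw [Measure.map_apply hφ (hK.image hp).isClosed.measurableSet]
  refine measure_mono_null ?_ hz
  rintro ω ⟨x, hx, hxω⟩
  obtain ⟨b, hb⟩ := hesurj ⟨x, hx⟩
  have hmem : φ ω ∈ range ((fun x => (g x).1) ∘ e') := by
    refine ⟨cantorSetHomeomorphNatToBool.symm b, ?_⟩
    simp only [e', Function.comp_apply, Homeomorph.apply_symm_apply, hb]
    exact hxω
  have h1 : (g (e' (s (φ ω)))).1 = φ ω := hsec _ hmem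
  change (φ ω, (g (e' (s (φ ω)))).2) ∈ M'
  have h2 : (φ ω, (g (e' (s (φ ω)))).2) = g (e' (s (φ ω))) := Prod.ext h1.symm rfl
  rw [h2, ← hgM]
  exact mem_range_self _

/-! ### Countable unions of atoms and sets of finite measure -/

section Exhausting

variable {Ω : Type*} [MeasurableSpace Ω] {μ : Measure Ω}

theorem IsAtomSigmaFinite.measurableSet {A : Set Ω} (hA : IsAtomSigmaFinite μ A) :
    MeasurableSet A := by
  obtain ⟨B, hB, rfl⟩ := hA
  exact MeasurableSet.iUnion fun n => (hB n).1

theorem isAtomSigmaFinite_of_measure_lt_top {A : Set Ω} (hA : MeasurableSet A) (h : μ A < ⊤) :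
    IsAtomSigmaFinite μ A :=
  ⟨fun _ => A, fun _ => ⟨hA, .inl h⟩, (iUnion_const A).symm⟩

theorem IsMeasureAtom.isAtomSigmaFinite {A : Set Ω} (hA : IsMeasureAtom μ A) :
    IsAtomSigmaFinite μ A :=
  ⟨fun _ => A, fun _ => ⟨hA.1, .inr hA⟩, (iUnion_const A).symm⟩

theorem IsAtomSigmaFinite.iUnion {A : ℕ → Set Ω} (hA : ∀ n, IsAtomSigmaFinite μ (A n)) :
    IsAtomSigmaFinite μ (⋃ n, A n) := by
  choose B hB hAB using hA
  refine ⟨fun k => B k.unpair.1 k.unpair.2, fun k => hB _ _, ?_⟩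
  ext ω
  simp only [hAB, mem_iUnion]
  constructor
  · rintro ⟨n, k, h⟩
    exact ⟨Nat.pair n k, by simpa using h⟩
  · rintro ⟨k, h⟩
    exact ⟨_, _, h⟩

theorem IsAtomSigmaFinite.union {A B : Set Ω} (hA : IsAtomSigmaFinite μ A)
    (hB : IsAtomSigmaFinite μ B) : IsAtomSigmaFinite μ (A ∪ B) := by
  have h : A ∪ B = ⋃ n : ℕ, if n = 0 then A else B := by
    ext ω
    simp only [mem_union, mem_iUnion]
    constructor
    · rintro (h | h)
      · exact ⟨0, by simpa using h⟩
      · exact ⟨1, by simpa using h⟩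
    · rintro ⟨n, hn⟩
      split_ifs at hn
      · exact .inl hn
      · exact .inr hn
  rw [h]
  refine IsAtomSigmaFinite.iUnion fun n => ?_
  split_ifs
  · exact hA
  · exact hB

/-- A family of functions that are measurable for the completion and agree almost everywhere on
common parts, indexed by the countable unions of atoms and sets of finite measure. -/
def IsConsistent {Y : Type*} [MeasurableSpace Y] (μ : Measure Ω) (α : Set Ω → Ω → Y) : Prop :=
  (∀ A, IsAtomSigmaFinite μ A → AEMeasurable (α A) (μ.restrict A)) ∧
    ∀ A B, IsAtomSigmaFinite μ A → IsAtomSigmaFinite μ B → A ⊆ B →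
      ∀ᵐ ω ∂(μ.restrict A), α A ω = α B ω

/-- The exhausting integral of a family of functions with values in `[0, ∞]`. -/
noncomputable def exhLIntegral (μ : Measure Ω) (g : Set Ω → Ω → ENNReal) : ENNReal :=
  ⨆ (A : Set Ω) (_ : IsAtomSigmaFinite μ A), ∫⁻ ω in A, g A ω ∂μ

section Consistent

variable {Y Z V : Type*} [MeasurableSpace Y] [MeasurableSpace Z] [MeasurableSpace V]

theorem isConsistent_const {g : Ω → Y}
    (hg : ∀ A, IsAtomSigmaFinite μ A → AEMeasurable g (μ.restrict A)) :
    IsConsistent μ fun _ => g :=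
  ⟨hg, fun _ _ _ _ _ => ae_of_all _ fun _ => rfl⟩

theorem IsConsistent.comp {α : Set Ω → Ω → Y} (hα : IsConsistent μ α) {φ : Y → Z}
    (hφ : Measurable φ) : IsConsistent μ fun A ω => φ (α A ω) :=
  ⟨fun A hA => hφ.comp_aemeasurable (hα.1 A hA), fun A B hA hB h => by
    filter_upwards [hα.2 A B hA hB h] with ω h1
    rw [h1]⟩

theorem IsConsistent.comp₂ {α : Set Ω → Ω → Y} {β : Set Ω → Ω → Z} (hα : IsConsistent μ α)
    (hβ : IsConsistent μ β) {φ : Y × Z → V} (hφ : Measurable φ) :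
    IsConsistent μ fun A ω => φ (α A ω, β A ω) :=
  ⟨fun A hA => hφ.comp_aemeasurable ((hα.1 A hA).prodMk (hβ.1 A hA)), fun A B hA hB h => by
    filter_upwards [hα.2 A B hA hB h, hβ.2 A B hA hB h] with ω h1 h2
    rw [h1, h2]⟩

end Consistent

/-! ### The exhausting integral -/

theorem exhLIntegral_mono {g g' : Set Ω → Ω → ENNReal}
    (h : ∀ A, IsAtomSigmaFinite μ A → ∀ᵐ ω ∂(μ.restrict A), g A ω ≤ g' A ω) :
    exhLIntegral μ g ≤ exhLIntegral μ g' :=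
  iSup₂_mono fun A hA => lintegral_mono_ae (h A hA)

theorem setLIntegral_le_exhLIntegral (g : Set Ω → Ω → ENNReal) {A : Set Ω}
    (hA : IsAtomSigmaFinite μ A) : ∫⁻ ω in A, g A ω ∂μ ≤ exhLIntegral μ g :=
  le_iSup₂ (f := fun A (_ : IsAtomSigmaFinite μ A) => ∫⁻ ω in A, g A ω ∂μ) A hA

theorem IsConsistent.setLIntegral_le {g : Set Ω → Ω → ENNReal} (hg : IsConsistent μ g)
    {A B : Set Ω} (hA : IsAtomSigmaFinite μ A) (hB : IsAtomSigmaFinite μ B) (h : A ⊆ B) :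
    ∫⁻ ω in A, g A ω ∂μ ≤ ∫⁻ ω in B, g B ω ∂μ :=
  (lintegral_congr_ae (hg.2 A B hA hB h)).trans_le (lintegral_mono_set h)

/-- Additivity holds since the index system is directed upwards. -/
theorem exhLIntegral_add {g g' : Set Ω → Ω → ENNReal} (hg : IsConsistent μ g)
    (hg' : IsConsistent μ g') :
    exhLIntegral μ (fun A ω => g A ω + g' A ω) = exhLIntegral μ g + exhLIntegral μ g' := by
  simp only [exhLIntegral, iSup_subtype']
  rw [ENNReal.iSup_add_iSup]
  · exact iSup_congr fun A => lintegral_add_left' (hg.1 A.1 A.2) _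
  · intro A B
    refine ⟨⟨A.1 ∪ B.1, A.2.union B.2⟩, add_le_add ?_ ?_⟩
    · exact hg.setLIntegral_le A.2 (A.2.union B.2) subset_union_left
    · exact hg'.setLIntegral_le B.2 (A.2.union B.2) subset_union_right

theorem exhPos_eq_exhLIntegral (α : Set Ω → Ω → EReal) :
    exhPos μ α = exhLIntegral μ fun A ω => (α A ω).toENNReal :=
  rfl

theorem exhPos_mono {α β : Set Ω → Ω → EReal}
    (h : ∀ A, IsAtomSigmaFinite μ A → ∀ᵐ ω ∂(μ.restrict A), α A ω ≤ β A ω) :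
    exhPos μ α ≤ exhPos μ β :=
  exhLIntegral_mono fun A hA => (h A hA).mono fun _ h => EReal.toENNReal_le_toENNReal h

theorem exhIntegralFamily_mono {α β : Set Ω → Ω → EReal}
    (h : ∀ A, IsAtomSigmaFinite μ A → ∀ᵐ ω ∂(μ.restrict A), α A ω ≤ β A ω) :
    exhIntegralFamily μ α ≤ exhIntegralFamily μ β := by
  unfold exhIntegralFamily
  have h1 := exhPos_mono h
  have h2 : exhPos μ (fun A ω => -β A ω) ≤ exhPos μ (fun A ω => -α A ω) :=
    exhPos_mono fun A hA => (h A hA).mono fun _ h => EReal.neg_le_neg_iff.2 h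
  split_ifs with ha hb hb
  · exact le_rfl
  · rw [ha] at h1
    exact absurd (top_le_iff.1 h1) hb
  · exact le_top
  · exact EReal.sub_le_sub (EReal.coe_ennreal_le_coe_ennreal_iff.2 h1)
      (EReal.coe_ennreal_le_coe_ennreal_iff.2 h2)

theorem exhIntegralFamily_congr {α β : Set Ω → Ω → EReal}
    (h : ∀ A, IsAtomSigmaFinite μ A → ∀ᵐ ω ∂(μ.restrict A), α A ω = β A ω) :
    exhIntegralFamily μ α = exhIntegralFamily μ β :=
  (exhIntegralFamily_mono fun A hA => (h A hA).mono fun _ => le_of_eq).antisymm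
    (exhIntegralFamily_mono fun A hA => (h A hA).mono fun _ => ge_of_eq)

theorem exhPos_ne_top_of_exhIntegralFamily_ne_top {α : Set Ω → Ω → EReal}
    (h : exhIntegralFamily μ α ≠ ⊤) : exhPos μ α ≠ ⊤ := by
  intro h'
  simp [exhIntegralFamily, h'] at h

theorem exhPos_neg_ne_top_of_exhIntegralFamily_ne_bot {α : Set Ω → Ω → EReal}
    (h : exhIntegralFamily μ α ≠ ⊥) (h' : exhIntegralFamily μ α ≠ ⊤) :
    exhPos μ (fun A ω => -α A ω) ≠ ⊤ := by
  intro hn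
  have := exhPos_ne_top_of_exhIntegralFamily_ne_top h'
  simp [exhIntegralFamily, hn, this] at h

/-- The relation between the positive and negative parts of `a`, `b` and `a - b`. Due to the
conventions `⊤ - ⊤ = ⊥ - ⊥ = ⊥` it needs no finiteness. -/
theorem toENNReal_sub_add (a b : EReal) :
    (a - b).toENNReal + ((-a).toENNReal + b.toENNReal) =
      (-(a - b)).toENNReal + (a.toENNReal + (-b).toENNReal) := by
  induction a with
  | bot => induction b <;> simp
  | top => induction b <;> simp
  | coe a =>
    induction b with
    | bot => simp
    | top => simp
    | coe b =>
      rw [← EReal.coe_sub, ← EReal.coe_neg, ← EReal.coe_neg, ← EReal.coe_neg]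
      simp only [EReal.real_coe_toENNReal]
      have h (x : ℝ) : ENNReal.ofReal x = ENNReal.ofReal (max x 0) := by simp
      rw [h (a - b), h (-a), h b, h (-(a - b)), h a, h (-b)]
      rw [← ENNReal.ofReal_add, ← ENNReal.ofReal_add, ← ENNReal.ofReal_add, ← ENNReal.ofReal_add]
        <;> try positivity
      congr 1
      have h' (x : ℝ) : max x 0 = max (-x) 0 + x := by
        have := max_zero_sub_max_neg_zero_eq_self x
        linarith
      have h1 := h' (a - b)
      have h2 := h' a
      have h3 := h' b
      linarith

theorem toENNReal_neg_sub_le (a b : EReal) :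
    (-(a - b)).toENNReal ≤ (-a).toENNReal + b.toENNReal := by
  induction a with
  | bot => induction b <;> simp
  | top => induction b <;> simp
  | coe a =>
    rw [EReal.neg_sub (by simp) (by simp)]
    exact EReal.toENNReal_add_le

theorem toENNReal_le_add_neg_sub (a b : EReal) :
    b.toENNReal ≤ a.toENNReal + (-(a - b)).toENNReal := by
  induction a with
  | bot => induction b <;> simp
  | top => induction b <;> simp
  | coe a =>
    induction b with
    | bot => simp
    | top => simp
    | coe b =>
      have h : (b : EReal) = (a : EReal) + (-((a : EReal) - b)) := by
        rw [← EReal.coe_sub, ← EReal.coe_neg, ← EReal.coe_add]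
        congr 1
        ring
      conv_lhs => rw [h]
      exact EReal.toENNReal_add_le

theorem measurable_ereal_neg : Measurable fun a : EReal => -a :=
  continuous_neg.measurable

theorem measurable_ereal_sub : Measurable fun p : EReal × EReal => p.1 - p.2 := by
  simp only [sub_eq_add_neg]
  exact measurable_fst.add (measurable_ereal_neg.comp measurable_snd)

theorem IsConsistent.sub {α β : Set Ω → Ω → EReal} (hα : IsConsistent μ α)
    (hβ : IsConsistent μ β) : IsConsistent μ fun A ω => α A ω - β A ω :=
  hα.comp₂ hβ measurable_ereal_sub

theorem IsConsistent.add {α β : Set Ω → Ω → ENNReal} (hα : IsConsistent μ α)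
    (hβ : IsConsistent μ β) : IsConsistent μ fun A ω => α A ω + β A ω :=
  hα.comp₂ hβ (measurable_fst.add measurable_snd)

theorem exhPos_sub_add {α β : Set Ω → Ω → EReal} (hα : IsConsistent μ α)
    (hβ : IsConsistent μ β) :
    exhPos μ (fun A ω => α A ω - β A ω) + (exhPos μ (fun A ω => -α A ω) + exhPos μ β) =
      exhPos μ (fun A ω => -(α A ω - β A ω)) +
        (exhPos μ α + exhPos μ (fun A ω => -β A ω)) := by
  have hm := measurable_ereal_toENNReal
  have hn := measurable_ereal_neg
  have hd : IsConsistent μ fun A ω => α A ω - β A ω := hα.sub hβ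
  simp only [exhPos_eq_exhLIntegral]
  rw [← exhLIntegral_add ((hα.comp hn).comp hm) (hβ.comp hm),
    ← exhLIntegral_add (hα.comp hm) ((hβ.comp hn).comp hm),
    ← exhLIntegral_add (hd.comp hm) (((hα.comp hn).comp hm).add (hβ.comp hm)),
    ← exhLIntegral_add ((hd.comp hn).comp hm) ((hα.comp hm).add ((hβ.comp hn).comp hm))]
  simp only [toENNReal_sub_add]

theorem exhIntegral_sub {α β : Set Ω → Ω → EReal} (hα : IsConsistent μ α)
    (hβ : IsConsistent μ β) (hα1 : exhPos μ α ≠ ⊤) (hα2 : exhPos μ (fun A ω => -α A ω) ≠ ⊤)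
    (hβ1 : exhPos μ β ≠ ⊤) :
    exhIntegralFamily μ (fun A ω => α A ω - β A ω) =
      exhIntegralFamily μ α - exhIntegralFamily μ β := by
  have hm := measurable_ereal_toENNReal
  have hn := measurable_ereal_neg
  have key := exhPos_sub_add hα hβ
  have hD' : exhPos μ (fun A ω => -(α A ω - β A ω)) ≠ ⊤ := by
    refine ne_top_of_le_ne_top (ENNReal.add_ne_top.2 ⟨hα2, hβ1⟩) ?_
    simp only [exhPos_eq_exhLIntegral]
    rw [← exhLIntegral_add ((hα.comp hn).comp hm) (hβ.comp hm)]
    exact exhLIntegral_mono fun A _ => ae_of_all _ fun ω => toENNReal_neg_sub_le _ _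
  simp only [exhIntegralFamily, if_neg hα1, if_neg hβ1]
  generalize exhPos μ (fun A ω => α A ω - β A ω) = D at *
  generalize exhPos μ (fun A ω => -(α A ω - β A ω)) = D' at *
  generalize exhPos μ (fun A ω => -α A ω) = Nα at *
  generalize exhPos μ (fun A ω => -β A ω) = Nβ at *
  generalize exhPos μ α = Pα at *
  generalize exhPos μ β = Pβ at *
  lift Nα to NNReal using hα2
  lift Pα to NNReal using hα1
  lift Pβ to NNReal using hβ1
  lift D' to NNReal using hD'
  simp only [EReal.coe_nnreal_eq_coe_real]
  by_cases hNβ : Nβ = ⊤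
  · have hD : D = ⊤ := by
      rw [hNβ] at key
      by_contra hD
      lift D to NNReal using hD
      simp only [add_top] at key
      exact absurd key (by norm_cast)
    subst hNβ
    subst hD
    simp [← EReal.coe_sub]
  · lift Nβ to NNReal using hNβ
    have hD : D ≠ ⊤ := by
      rintro rfl
      rw [top_add] at key
      exact absurd key.symm (by norm_cast)
    lift D to NNReal using hD
    rw [if_neg ENNReal.coe_ne_top]
    simp only [EReal.coe_nnreal_eq_coe_real, ← EReal.coe_sub]
    norm_cast at key ⊢
    have key' := congrArg NNReal.toReal key
    push_cast at key'
    linarith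

theorem ae_ne_top_of_exhPos_ne_top {α : Set Ω → Ω → EReal} (hα : IsConsistent μ α)
    (h : exhPos μ α ≠ ⊤) {A : Set Ω} (hA : IsAtomSigmaFinite μ A) :
    ∀ᵐ ω ∂(μ.restrict A), α A ω ≠ ⊤ := by
  have h1 := ae_lt_top' ((hα.1 A hA).ereal_toENNReal) (ne_top_of_le_ne_top h
    (setLIntegral_le_exhLIntegral (fun A ω => (α A ω).toENNReal) hA))
  filter_upwards [h1] with ω h2
  exact EReal.toENNReal_ne_top_iff.1 h2.ne

theorem ae_real_of_exhIntegralFamily {α : Set Ω → Ω → EReal} (hα : IsConsistent μ α)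
    (h : exhIntegralFamily μ α ≠ ⊥) (h' : exhIntegralFamily μ α ≠ ⊤) {A : Set Ω}
    (hA : IsAtomSigmaFinite μ A) :
    ∀ᵐ ω ∂(μ.restrict A), α A ω ≠ ⊥ ∧ α A ω ≠ ⊤ := by
  filter_upwards [ae_ne_top_of_exhPos_ne_top hα
      (exhPos_ne_top_of_exhIntegralFamily_ne_top h') hA,
    ae_ne_top_of_exhPos_ne_top (hα.comp measurable_ereal_neg)
      (exhPos_neg_ne_top_of_exhIntegralFamily_ne_bot h h') hA] with ω h1 h2
  exact ⟨fun h => h2 (by simp [h]), h1⟩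

/-- Above a family with finite integral, the exhausting integral is the sum of that integral and
the exhausting integral of the nonnegative difference. -/
theorem exhIntegralFamily_eq_add_exhPos_sub {α β : Set Ω → Ω → EReal} (hα : IsConsistent μ α)
    (hβ : IsConsistent μ β)
    (hle : ∀ A, IsAtomSigmaFinite μ A → ∀ᵐ ω ∂(μ.restrict A), β A ω ≤ α A ω)
    (h : exhIntegralFamily μ β ≠ ⊥) (h' : exhIntegralFamily μ β ≠ ⊤) :
    exhIntegralFamily μ α =
      exhIntegralFamily μ β + (exhPos μ (fun A ω => α A ω - β A ω) : EReal) := by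
  have hP := exhPos_ne_top_of_exhIntegralFamily_ne_top h'
  have hN := exhPos_neg_ne_top_of_exhIntegralFamily_ne_bot h h'
  have key := exhPos_sub_add hα hβ
  have hD' : exhPos μ (fun A ω => -(α A ω - β A ω)) = 0 := by
    have h0 : exhPos μ (fun A ω => -(α A ω - β A ω)) ≤ exhPos μ fun (_ : Set Ω) (_ : Ω) => 0 := by
      refine exhPos_mono fun A hA => ?_
      filter_upwards [hle A hA, ae_real_of_exhIntegralFamily hβ h h' hA] with ω h1 h2
      rw [EReal.neg_le, neg_zero]
      exact (EReal.sub_nonneg (.inr h2.2) (.inr h2.1)).2 h1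
    simpa [exhPos] using h0
  have hNα : exhPos μ (fun A ω => -α A ω) ≠ ⊤ :=
    ne_top_of_le_ne_top hN (exhPos_mono fun A hA =>
      (hle A hA).mono fun _ h => EReal.neg_le_neg_iff.2 h)
  rw [hD', zero_add] at key
  simp only [exhIntegralFamily, if_neg hP]
  generalize exhPos μ (fun A ω => α A ω - β A ω) = D at *
  generalize exhPos μ (fun A ω => -α A ω) = Nα at *
  generalize exhPos μ (fun A ω => -β A ω) = Nβ at *
  generalize exhPos μ α = Pα at *
  generalize exhPos μ β = Pβ at *
  lift Nα to NNReal using hNα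
  lift Nβ to NNReal using hN
  lift Pβ to NNReal using hP
  simp only [EReal.coe_nnreal_eq_coe_real]
  by_cases hPα : Pα = ⊤
  · have hD : D = ⊤ := by
      rw [hPα, top_add] at key
      by_contra hD
      lift D to NNReal using hD
      exact absurd key (by norm_cast)
    subst hPα
    subst hD
    simp [← EReal.coe_sub]
  · lift Pα to NNReal using hPα
    have hD : D ≠ ⊤ := by
      rintro rfl
      rw [top_add] at key
      exact absurd key.symm (by norm_cast)
    lift D to NNReal using hD
    rw [if_neg ENNReal.coe_ne_top]
    simp only [EReal.coe_nnreal_eq_coe_real, ← EReal.coe_sub]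
    norm_cast at key ⊢
    have key' := congrArg NNReal.toReal key
    push_cast at key'
    linarith

theorem exhPos_le_exhPos_add_exhPos_neg_sub {α β : Set Ω → Ω → EReal} (hα : IsConsistent μ α)
    (hβ : IsConsistent μ β) :
    exhPos μ β ≤ exhPos μ α + exhPos μ (fun A ω => -(α A ω - β A ω)) := by
  have hm := measurable_ereal_toENNReal
  simp only [exhPos_eq_exhLIntegral]
  rw [← exhLIntegral_add (hα.comp hm)
    (((hα.sub hβ).comp measurable_ereal_neg).comp hm)]
  exact exhLIntegral_mono fun A _ => ae_of_all _ fun ω => toENNReal_le_add_neg_sub _ _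

end Exhausting

section EssentialSupremum

variable {Ω : Type*} [MeasurableSpace Ω]

/-! ### Essential suprema of directed families -/

/-- A directed family of measurable functions contains an increasing sequence whose supremum is an
almost everywhere upper bound of the whole family. The sequence is a minimizing one for the
integrals of a strictly decreasing bounded transform of the functions. -/
theorem exists_monotone_seq_ae_le_iSup {ι : Type*} [Nonempty ι] (ν : Measure Ω) [SFinite ν]
    {g : ι → Ω → EReal} (hg : ∀ i, AEMeasurable (g i) ν)
    (hdir : ∀ i j, ∃ k, ∀ᵐ ω ∂ν, g i ω ≤ g k ω ∧ g j ω ≤ g k ω) :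
    ∃ i : ℕ → ι, (∀ᵐ ω ∂ν, Monotone fun k => g (i k) ω) ∧
      ∀ j, ∀ᵐ ω ∂ν, g j ω ≤ ⨆ k, g (i k) ω := by
  obtain ⟨ν', hν', hνν', hν'ν⟩ := exists_isFiniteMeasure_absolutelyContinuous ν
  let θ : EReal → ENNReal := fun a => (1 + a.exp)⁻¹
  have hθ : ∀ a b, θ a ≤ θ b ↔ b ≤ a := fun a b => by
    simp only [θ, ENNReal.inv_le_inv]
    rw [ENNReal.add_le_add_iff_left ENNReal.one_ne_top, EReal.exp_le_exp_iff]
  have hθanti : Antitone θ := fun a b h => (hθ b a).2 h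
  have hθm : Measurable θ := hθanti.measurable
  have hθ1 : ∀ a, θ a ≤ 1 := fun a => ENNReal.inv_le_one.2 le_self_add
  have hθsup : ∀ a : ℕ → EReal, θ (⨆ k, a k) = ⨅ k, θ (a k) := fun a => by
    simp only [θ]
    have h1 : EReal.exp (⨆ k, a k) = ⨆ k, EReal.exp (a k) := EReal.expOrderIso.map_iSup a
    rw [h1, ENNReal.add_iSup, ENNReal.inv_iSup]
  have hgm : ∀ i, AEMeasurable (fun ω => θ (g i ω)) ν' := fun i =>
    hθm.comp_aemeasurable ((hg i).mono_ac hν'ν)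
  let J : ι → ENNReal := fun i => ∫⁻ ω, θ (g i ω) ∂ν'
  obtain ⟨y, -, hy, hyJ⟩ := exists_seq_tendsto_sInf (range_nonempty J) (OrderBot.bddBelow _)
  choose j hj using hyJ
  choose c hc using hdir
  let i : ℕ → ι := fun k => Nat.rec (j 0) (fun k ik => c ik (j (k + 1))) k
  have hmono : ∀ᵐ ω ∂ν, Monotone fun k => g (i k) ω := by
    have : ∀ᵐ ω ∂ν, ∀ k, g (i k) ω ≤ g (i (k + 1)) ω :=
      ae_all_iff.2 fun k => (hc (i k) (j (k + 1))).mono fun ω h => h.1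
    exact this.mono fun ω h => monotone_nat_of_le_succ h
  have hij : ∀ k, J (i k) ≤ y k := by
    intro k
    rw [← hj k]
    refine lintegral_mono_ae (hν'ν.ae_le ?_)
    cases k with
    | zero => exact ae_of_all _ fun ω => le_rfl
    | succ k => exact (hc (i k) (j (k + 1))).mono fun ω h => hθanti h.2
  refine ⟨i, hmono, fun l => ?_⟩
  let I := sInf (range J)
  have hβI : ∫⁻ ω, θ (⨆ k, g (i k) ω) ∂ν' ≤ I := by
    refine ge_of_tendsto' hy fun k => le_trans (lintegral_mono fun ω => ?_) (hij k)
    exact hθanti (le_iSup (fun k => g (i k) ω) k)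
  have hmin : I ≤ ∫⁻ ω, min (θ (⨆ k, g (i k) ω)) (θ (g l ω)) ∂ν' := by
    have h1 : ∀ ω, min (θ (⨆ k, g (i k) ω)) (θ (g l ω)) =
        ⨅ k, min (θ (g (i k) ω)) (θ (g l ω)) := fun ω => by
      rw [hθsup]
      exact iInf_inf
    simp only [h1]
    rw [lintegral_iInf' (fun k => (hgm (i k)).min (hgm l))]
    · refine le_iInf fun k => le_trans (sInf_le (mem_range_self (c (i k) l))) ?_
      refine lintegral_mono_ae (hν'ν.ae_le ?_)
      filter_upwards [hc (i k) l] with ω h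
      exact le_min (hθanti h.1) (hθanti h.2)
    · refine hν'ν.ae_le ?_
      filter_upwards [hmono] with ω h k k' hk
      exact min_le_min_right _ (hθanti (h hk))
    · refine ne_top_of_le_ne_top (measure_ne_top ν' univ) ?_
      refine (lintegral_mono fun ω => (min_le_left _ _).trans (hθ1 _)).trans ?_
      simp
  have heq : (fun ω => min (θ (⨆ k, g (i k) ω)) (θ (g l ω))) =ᵐ[ν']
      fun ω => θ (⨆ k, g (i k) ω) := by
    refine ae_eq_of_ae_le_of_lintegral_le (ae_of_all _ fun ω => min_le_left _ _) ?_ ?_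
      (hβI.trans hmin)
    · refine ne_top_of_le_ne_top (measure_ne_top ν' univ) ?_
      refine (lintegral_mono fun ω => (min_le_left _ _).trans (hθ1 _)).trans ?_
      simp
    · exact hθm.comp_aemeasurable
        (AEMeasurable.iSup fun k => (hg (i k)).mono_ac hν'ν)
  refine hνν'.ae_le ?_
  filter_upwards [heq] with ω h
  exact (hθ _ _).1 (min_eq_left_iff.1 h)

end EssentialSupremum

/-! ### Infinite atoms and the part of finite measure -/

section Atoms

variable {Ω : Type*} [MeasurableSpace Ω] {μ : Measure Ω}

/-- On an atom of infinite measure, every function with finite integral vanishes. -/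
theorem IsMeasureAtom.ae_eq_zero_of_lintegral_ne_top {B : Set Ω} (hB : IsMeasureAtom μ B)
    (hμB : μ B = ⊤) {g : Ω → ENNReal} (hg : AEMeasurable g (μ.restrict B))
    (hfin : ∫⁻ ω in B, g ω ∂μ ≠ ⊤) : ∀ᵐ ω ∂(μ.restrict B), g ω = 0 := by
  -- The level sets have finite measure by Markov's inequality, so they are null.
  have hmk : ∀ᵐ ω ∂(μ.restrict B), hg.mk g ω = 0 := by
    have key : ∀ n : ℕ, (μ.restrict B) {ω | (n + 1 : ENNReal)⁻¹ ≤ hg.mk g ω} = 0 := by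
      intro n
      have hm : MeasurableSet {ω | (n + 1 : ENNReal)⁻¹ ≤ hg.mk g ω} :=
        measurableSet_le measurable_const hg.measurable_mk
      have hlt : (μ.restrict B) {ω | (n + 1 : ENNReal)⁻¹ ≤ hg.mk g ω} < ⊤ := by
        refine (meas_ge_le_lintegral_div hg.measurable_mk.aemeasurable (by simp) ?_).trans_lt ?_
        · simp
        · refine ENNReal.div_lt_top ?_ (by simp)
          rwa [← lintegral_congr_ae hg.ae_eq_mk]
      rw [Measure.restrict_apply hm] at hlt ⊢
      refine (hB.2.2 _ (hm.inter hB.1) inter_subset_right).resolve_right fun h => ?_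
      rw [h, hμB] at hlt
      exact lt_irrefl _ hlt
    have hall : ∀ᵐ ω ∂(μ.restrict B), ∀ n : ℕ, hg.mk g ω < (n + 1 : ENNReal)⁻¹ := by
      refine ae_all_iff.2 fun n => ?_
      rw [ae_iff]
      simpa only [not_lt] using key n
    filter_upwards [hall] with ω h
    by_contra h0
    obtain ⟨n, hn⟩ := ENNReal.exists_inv_nat_lt h0
    refine absurd (hn.trans (h n)) (not_lt.2 ?_)
    exact ENNReal.inv_le_inv.2 le_self_add
  filter_upwards [hg.ae_eq_mk, hmk] with ω h1 h2
  rw [h1, h2]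

/-- A countable union of atoms and sets of finite measure consists of an increasing union of sets of
finite measure and of atoms of infinite measure. -/
theorem IsAtomSigmaFinite.exists_decomposition {A : Set Ω} (hA : IsAtomSigmaFinite μ A) :
    ∃ D : ℕ → Set Ω, (∀ n, MeasurableSet (D n)) ∧ Monotone D ∧ (∀ n, μ (D n) < ⊤) ∧
      (⋃ n, D n) ⊆ A ∧ ∀ p : Ω → Prop, (∀ᵐ ω ∂(μ.restrict (⋃ n, D n)), p ω) →
        (∀ B ⊆ A, IsMeasureAtom μ B → μ B = ⊤ → ∀ᵐ ω ∂(μ.restrict B), p ω) →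
        ∀ᵐ ω ∂(μ.restrict A), p ω := by
  classical
  obtain ⟨B, hB, rfl⟩ := hA
  let F : ℕ → Set Ω := fun n => if μ (B n) < ⊤ then B n else ∅
  have hFB : ∀ n, F n ⊆ B n := fun n => by
    simp only [F]
    split_ifs
    · exact le_rfl
    · exact empty_subset _
  have hFm : ∀ n, MeasurableSet (F n) := fun n => by
    simp only [F]
    split_ifs
    · exact (hB n).1
    · exact MeasurableSet.empty
  have hFfin : ∀ n, μ (F n) < ⊤ := fun n => by
    simp only [F]
    split_ifs with h
    · exact h
    · simp
  refine ⟨accumulate F, fun n => ?_, monotone_accumulate, fun n => ?_, ?_, fun p hp hp' => ?_⟩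
  · exact MeasurableSet.biUnion (to_countable _) fun k _ => hFm k
  · exact measure_biUnion_lt_top (finite_Iic n) fun k _ => hFfin k
  · rw [iUnion_accumulate]
    exact iUnion_mono hFB
  · rw [iUnion_accumulate, ae_restrict_iUnion_iff] at hp
    rw [ae_restrict_iUnion_iff]
    intro n
    by_cases h : μ (B n) < ⊤
    · have := hp n
      simpa only [F, if_pos h] using this
    · exact hp' _ (subset_iUnion B n) ((hB n).2.resolve_left h) (not_lt_top_iff.1 h)

theorem IsMeasureAtom.ae_notMem_of_measure_lt_top {B : Set Ω} (hB : IsMeasureAtom μ B)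
    (hμB : μ B = ⊤) {D : Set Ω} (hD : MeasurableSet D) (hμD : μ D < ⊤) :
    ∀ᵐ ω ∂(μ.restrict B), ω ∉ D := by
  rw [ae_iff]
  simp only [not_not]
  have : (μ.restrict B) D = 0 := by
    rw [Measure.restrict_apply hD]
    refine (hB.2.2 _ (hD.inter hB.1) inter_subset_right).resolve_right fun h => ?_
    rw [hμB] at h
    exact absurd ((measure_mono inter_subset_left).trans_lt hμD) (by rw [h]; exact lt_irrefl _)
  exact this

end Atoms

/-! ### Integrands along strongly measurable functions -/

section FenchelTerm

variable {Ω X : Type*} [NormedAddCommGroup X] [NormedSpace ℝ X]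

/-- The function `ω ↦ ⟨v ω, w ω⟩ - f (ω, w ω)`, one term of the supremum defining the conjugate
`f*(ω, v ω)`. -/
noncomputable def fenchelTerm (f : Ω → X → EReal) (v : Ω → StrongDual ℝ X) (w : Ω → X)
    (ω : Ω) : EReal :=
  ((v ω (w ω) : ℝ) : EReal) - f ω (w ω)

theorem fenchelTerm_le_conjOn {f : Ω → X → EReal} {v : Ω → StrongDual ℝ X} {w : Ω → X} {ω : Ω}
    {W : Set X} (h : w ω ∈ W) : fenchelTerm f v w ω ≤ conjOn (f ω) W (v ω) :=
  le_iSup₂ (f := fun x (_ : x ∈ W) => ((v ω x : ℝ) : EReal) - f ω x) (w ω) h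

theorem conjOn_mono {h : X → EReal} {W W' : Set X} (hW : W ⊆ W') (ξ : StrongDual ℝ X) :
    conjOn h W ξ ≤ conjOn h W' ξ :=
  biSup_mono fun _ hx => hW hx

end FenchelTerm

theorem measurable_comp_of_measurable_prod {Ω X Z : Type*} [MeasurableSpace Ω]
    [NormedAddCommGroup X] [MeasurableSpace X] [BorelSpace X] [MeasurableSpace Z] {A : Set Ω}
    {w : Ω → X} (hw : StronglyMeasurable fun ω : A => w ω) {k : Ω → X → Z}
    (hk : ∀ W : Set X, TopologicalSpace.IsSeparable W → Measurable fun p : A × W => k p.1 p.2) :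
    Measurable fun ω : A => k ω (w ω) := by
  have h := hk _ hw.isSeparable_range
  exact h.comp (measurable_id.prodMk
    (hw.measurable.subtype_mk (h := fun ω => mem_range_self ω)))

theorem IntegrallySeparablyMeasurable.measurable_apply {Ω X : Type*} [MeasurableSpace Ω]
    [NormedAddCommGroup X] [MeasurableSpace X] [BorelSpace X] {μ : Measure Ω} {f : Ω → X → EReal}
    (hf : IntegrallySeparablyMeasurable μ f) {A : Set Ω} (hA : IsAtomSigmaFinite μ A)
    {w : Ω → X} (hw : StronglyMeasurable fun ω : A => w ω) :
    Measurable fun ω : A => f ω (w ω) :=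
  measurable_comp_of_measurable_prod hw fun W hW => hf A hA W hW

section Integrands

variable {Ω X : Type*} [MeasurableSpace Ω] [NormedAddCommGroup X] [NormedSpace ℝ X]
  {μ : Measure Ω} [MeasurableSpace X] [BorelSpace X]

theorem IntegrallyWeakStarMeasurable.measurable_prod {v : Ω → StrongDual ℝ X}
    (hv : IntegrallyWeakStarMeasurable μ v) {A : Set Ω} (hA : IsAtomSigmaFinite μ A) {W : Set X}
    (hW : TopologicalSpace.IsSeparable W) :
    Measurable fun p : A × W => v p.1 (p.2 : X) := by
  have := hW.secondCountableTopology
  have h := measurable_uncurry_of_continuous_of_measurable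
    (u := fun (x : W) (ω : A) => v ω (x : X))
    (fun ω => (v ω).continuous.comp continuous_subtype_val) (fun x => hv A hA x)
  exact h.comp measurable_swap

theorem IntegrallyWeakStarMeasurable.measurable_apply {v : Ω → StrongDual ℝ X}
    (hv : IntegrallyWeakStarMeasurable μ v) {A : Set Ω} (hA : IsAtomSigmaFinite μ A)
    {w : Ω → X} (hw : StronglyMeasurable fun ω : A => w ω) :
    Measurable fun ω : A => ((v ω (w ω) : ℝ) : EReal) :=
  (measurable_comp_of_measurable_prod (k := fun ω x => v ω x) hw
    fun _ hW => hv.measurable_prod hA hW).coe_real_ereal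

theorem measurable_fenchelTerm {f : Ω → X → EReal} {v : Ω → StrongDual ℝ X}
    (hf : IntegrallySeparablyMeasurable μ f) (hv : IntegrallyWeakStarMeasurable μ v)
    {A : Set Ω} (hA : IsAtomSigmaFinite μ A)
    {w : Ω → X} (hw : StronglyMeasurable fun ω : A => w ω) :
    Measurable fun ω : A => fenchelTerm f v w ω :=
  measurable_ereal_sub.comp ((hv.measurable_apply hA hw).prodMk (hf.measurable_apply hA hw))

/-- A function that is, up to null sets, above `⟨v, w⟩ - f(·, w)` for every strongly measurable `w`
is above the conjugate of the restriction of `f` to any separable set: otherwise measurable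
selection would yield a strongly measurable `w` violating the assumption. -/
theorem ae_conjOn_le_of_forall_fenchelTerm_le [CompleteSpace X] {f : Ω → X → EReal}
    {v : Ω → StrongDual ℝ X} (hf : IntegrallySeparablyMeasurable μ f)
    (hv : IntegrallyWeakStarMeasurable μ v) {A : Set Ω} (hA : IsAtomSigmaFinite μ A)
    [SFinite (μ.restrict A)] {β : Ω → EReal} (hβ : AEMeasurable β (μ.restrict A))
    (h : ∀ w : Ω → X, StronglyMeasurable w → ∀ᵐ ω ∂(μ.restrict A), fenchelTerm f v w ω ≤ β ω)
    {W : Set X} (hW : TopologicalSpace.IsSeparable W) :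
    ∀ᵐ ω ∂(μ.restrict A), conjOn (f ω) W (v ω) ≤ β ω := by
  obtain ⟨ν, hν, hμν, hνμ⟩ := exists_isFiniteMeasure_absolutelyContinuous (μ.restrict A)
  have hcl := hW.closure
  have : TopologicalSpace.SeparableSpace (closure W) := hcl.separableSpace
  have : SecondCountableTopology (closure W) := hcl.secondCountableTopology
  have : CompleteSpace (closure W) := isClosed_closure.completeSpace_coe
  let M₀ : Set (A × closure W) := {p | hβ.mk β p.1 < ((v p.1 (p.2 : X) : ℝ) : EReal) - f p.1 p.2}
  have hM₀ : MeasurableSet M₀ := by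
    refine measurableSet_lt (hβ.measurable_mk.comp (measurable_subtype_coe.comp measurable_fst)) ?_
    exact measurable_ereal_sub.comp
      ((hv.measurable_prod hA hcl).coe_real_ereal.prodMk (hf A hA _ hcl))
  let M : Set (Ω × closure W) := Prod.map Subtype.val id '' M₀
  have hM : MeasurableSet M :=
    ((MeasurableEmbedding.subtype_coe hA.measurableSet).prodMap .id).measurableSet_image.2 hM₀
  have hnull : ν (Prod.fst '' M) = 0 := by
    by_contra h0
    obtain ⟨s, hs, hsM⟩ := exists_measurable_selection ν hM h0
    refine hsM (nonpos_iff_eq_zero.1 ?_)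
    have hw : StronglyMeasurable fun ω => (s ω : X) :=
      continuous_subtype_val.comp_stronglyMeasurable hs.stronglyMeasurable
    have hle : ∀ᵐ ω ∂ν, (ω, s ω) ∉ M := by
      refine hνμ.ae_le ?_
      filter_upwards [h _ hw, hβ.ae_eq_mk] with ω h1 h2
      rintro ⟨⟨a, x⟩, hp, heq⟩
      obtain ⟨rfl, rfl⟩ := Prod.mk.inj heq
      rw [h2] at h1
      exact absurd hp (not_lt.2 h1)
    rw [ae_iff] at hle
    simpa only [not_not] using hle.le
  have hae : ∀ᵐ ω ∂(μ.restrict A), ω ∉ Prod.fst '' M := by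
    exact hμν.ae_le (measure_eq_zero_iff_ae_notMem.1 hnull)
  filter_upwards [hae, hβ.ae_eq_mk, ae_restrict_mem hA.measurableSet] with ω h1 h2 hω
  refine iSup₂_le fun x hx => ?_
  by_contra hlt
  rw [h2, not_le] at hlt
  exact h1 ⟨(ω, ⟨x, subset_closure hx⟩), ⟨(⟨ω, hω⟩, ⟨x, subset_closure hx⟩), hlt, rfl⟩, rfl⟩

end Integrands

/-! ### Essential suprema of the restricted conjugates -/

section ConjEssSup

variable {Ω X : Type*} [MeasurableSpace Ω] [NormedAddCommGroup X] [NormedSpace ℝ X]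

/-- `α` is an essential supremum function on `A` of the conjugates of the restrictions of `f` to
separable sets. -/
def IsConjEssSup (μ : Measure Ω) (f : Ω → X → EReal) (v : Ω → StrongDual ℝ X) (A : Set Ω)
    (α : Ω → EReal) : Prop :=
  IsEssSup (μ.restrict A)
    (fun (W : {W : Set X // TopologicalSpace.IsSeparable W}) ω => conjOn (f ω) W.1 (v ω)) α

variable {μ : Measure Ω} {f : Ω → X → EReal} {v : Ω → StrongDual ℝ X}

theorem IsConjEssSup.conjOn_le {A : Set Ω} {α : Ω → EReal} (hα : IsConjEssSup μ f v A α)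
    {W : Set X} (hW : TopologicalSpace.IsSeparable W) :
    ∀ᵐ ω ∂(μ.restrict A), conjOn (f ω) W (v ω) ≤ α ω :=
  hα.2.1 ⟨W, hW⟩

theorem IsConjEssSup.ae_unique {A : Set Ω} {α β : Ω → EReal} (hα : IsConjEssSup μ f v A α)
    (hβ : IsConjEssSup μ f v A β) : ∀ᵐ ω ∂(μ.restrict A), α ω = β ω := by
  filter_upwards [hα.2.2 β hβ.1 hβ.2.1, hβ.2.2 α hα.1 hα.2.1] with ω h1 h2
  exact le_antisymm h1 h2

end ConjEssSup

section Paired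

variable {Ω X : Type*} [MeasurableSpace Ω] [NormedAddCommGroup X] [NormedSpace ℝ X]
  [MeasurableSpace X]

/-- The standing assumptions on a decomposable set `R` of functions, an integrand `f` and a single
dual function `v`. -/
structure IsPaired (μ : Measure Ω) (R : Set (Ω → X)) (f : Ω → X → EReal)
    (v : Ω → StrongDual ℝ X) : Prop where
  stronglyMeasurable : ∀ u ∈ R, IntegrallyStronglyMeasurable μ u
  decomposable : AlmostDecomposable μ R
  weakStar : IntegrallyWeakStarMeasurable μ v
  pairing_real : ∀ u ∈ R, pairing μ u v ≠ ⊥ ∧ pairing μ u v ≠ ⊤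
  integrand : IntegrallySeparablyMeasurable μ f
  conjOn_nonpos : ∀ A : Set Ω, IsMeasureAtom μ A → μ A = ⊤ →
    ∀ W : Set X, TopologicalSpace.IsSeparable W → ∀ᵐ ω ∂(μ.restrict A), conjOn (f ω) W (v ω) ≤ 0

variable {μ : Measure Ω} {R : Set (Ω → X)} {f : Ω → X → EReal} {v : Ω → StrongDual ℝ X}

theorem IsPaired.exhPos_apply_ne_top (h : IsPaired μ R f v) {u : Ω → X} (hu : u ∈ R) :
    exhPos μ (fun _ ω => ((v ω (u ω) : ℝ) : EReal)) ≠ ⊤ :=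
  exhPos_ne_top_of_exhIntegralFamily_ne_top (h.pairing_real u hu).2

theorem IsPaired.exhPos_neg_apply_ne_top (h : IsPaired μ R f v) {u : Ω → X} (hu : u ∈ R) :
    exhPos μ (fun _ ω => -((v ω (u ω) : ℝ) : EReal)) ≠ ⊤ :=
  exhPos_neg_ne_top_of_exhIntegralFamily_ne_bot (h.pairing_real u hu).1 (h.pairing_real u hu).2

theorem IsPaired.fenchelTerm_le_of_isConjEssSup (h : IsPaired μ R f v) {u : Ω → X}
    (hu : u ∈ R) {A : Set Ω} (hA : IsAtomSigmaFinite μ A) {α : Ω → EReal}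
    (hα : IsConjEssSup μ f v A α) : ∀ᵐ ω ∂(μ.restrict A), fenchelTerm f v u ω ≤ α ω := by
  filter_upwards [hα.conjOn_le (h.stronglyMeasurable u hu A hA).isSeparable_range,
    ae_restrict_mem hA.measurableSet] with ω h1 h2
  exact le_trans (fenchelTerm_le_conjOn (W := range fun ω : A => u ω) ⟨⟨ω, h2⟩, rfl⟩) h1

variable [BorelSpace X]

theorem IsPaired.isConsistent_apply (h : IsPaired μ R f v) {u : Ω → X} (hu : u ∈ R) :
    IsConsistent μ fun _ ω => ((v ω (u ω) : ℝ) : EReal) :=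
  isConsistent_const fun A hA => aemeasurable_restrict_of_measurable_subtype hA.measurableSet
    (h.weakStar.measurable_apply hA (h.stronglyMeasurable u hu A hA))

theorem IsPaired.isConsistent_integrand (h : IsPaired μ R f v) {u : Ω → X} (hu : u ∈ R) :
    IsConsistent μ fun _ ω => f ω (u ω) :=
  isConsistent_const fun A hA => aemeasurable_restrict_of_measurable_subtype hA.measurableSet
    (h.integrand.measurable_apply hA (h.stronglyMeasurable u hu A hA))

theorem IsPaired.isConsistent_fenchelTerm (h : IsPaired μ R f v) {u : Ω → X} (hu : u ∈ R) :
    IsConsistent μ fun _ => fenchelTerm f v u :=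
  (h.isConsistent_apply hu).sub (h.isConsistent_integrand hu)

theorem IsPaired.pairing_sub_integralFunctional (h : IsPaired μ R f v) {u : Ω → X} (hu : u ∈ R)
    (hfu : integralFunctional μ f u ≠ ⊤) :
    pairing μ u v - integralFunctional μ f u = exhIntegral μ (fenchelTerm f v u) :=
  (exhIntegral_sub (h.isConsistent_apply hu) (h.isConsistent_integrand hu)
    (h.exhPos_apply_ne_top hu) (h.exhPos_neg_apply_ne_top hu)
    (exhPos_ne_top_of_exhIntegralFamily_ne_top hfu)).symm

theorem IsPaired.exhIntegral_fenchelTerm_ne_bot (h : IsPaired μ R f v) {u : Ω → X} (hu : u ∈ R)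
    (hfu : integralFunctional μ f u ≠ ⊤) : exhIntegral μ (fenchelTerm f v u) ≠ ⊥ := by
  rw [← h.pairing_sub_integralFunctional hu hfu]
  obtain ⟨h1, h2⟩ := h.pairing_real u hu
  lift pairing μ u v to ℝ using ⟨h2, h1⟩ with p
  generalize integralFunctional μ f u = q at hfu
  induction q with
  | bot => simp
  | top => exact absurd rfl hfu
  | coe q =>
    rw [← EReal.coe_sub]
    exact EReal.coe_ne_bot _

theorem IsPaired.exhIntegral_fenchelTerm_le (h : IsPaired μ R f v) {u : Ω → X} (hu : u ∈ R)
    (hfu : integralFunctional μ f u ≠ ⊤) :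
    exhIntegral μ (fenchelTerm f v u) ≤ integralConjugate μ R f v := by
  rw [← h.pairing_sub_integralFunctional hu hfu]
  exact le_iSup₂ (f := fun u (_ : u ∈ R) => pairing μ u v - integralFunctional μ f u) u hu

/-- On an atom of infinite measure all integrals that are finite vanish, so that
`⟨v, u⟩ - f(·, u)` vanishes for every `u` in the domain of the integral functional. -/
theorem IsPaired.fenchelTerm_ae_eq_zero (h : IsPaired μ R f v) {u : Ω → X} (hu : u ∈ R)
    (hfu : integralFunctional μ f u ≠ ⊤) {B : Set Ω} (hB : IsMeasureAtom μ B) (hμB : μ B = ⊤) :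
    ∀ᵐ ω ∂(μ.restrict B), fenchelTerm f v u ω = 0 := by
  have hBA := hB.isAtomSigmaFinite
  have key : ∀ α : Ω → EReal, IsConsistent μ (fun _ => α) → exhPos μ (fun _ => α) ≠ ⊤ →
      ∀ᵐ ω ∂(μ.restrict B), α ω ≤ 0 := fun α hα hfin => by
    have h1 := hB.ae_eq_zero_of_lintegral_ne_top hμB (hα.1 B hBA).ereal_toENNReal
      (ne_top_of_le_ne_top hfin
        (setLIntegral_le_exhLIntegral (fun _ ω => (α ω).toENNReal) hBA))
    exact h1.mono fun ω => EReal.toENNReal_eq_zero_iff.1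
  have hum := h.stronglyMeasurable u hu B hBA
  filter_upwards [key _ (h.isConsistent_apply hu) (h.exhPos_apply_ne_top hu),
    key _ ((h.isConsistent_apply hu).comp measurable_ereal_neg) (h.exhPos_neg_apply_ne_top hu),
    key _ (h.isConsistent_integrand hu) (exhPos_ne_top_of_exhIntegralFamily_ne_top hfu),
    h.conjOn_nonpos B hB hμB _ hum.isSeparable_range,
    ae_restrict_mem hB.1] with ω h1 h2 h3 h4 h5
  refine le_antisymm ((fenchelTerm_le_conjOn ?_).trans h4) ?_
  · exact ⟨⟨ω, h5⟩, rfl⟩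
  · have h0 : ((v ω (u ω) : ℝ) : EReal) = 0 := by
      refine le_antisymm h1 ?_
      rwa [EReal.neg_le, neg_zero] at h2
    rw [fenchelTerm, h0, zero_sub]
    rwa [EReal.le_neg, neg_zero]

theorem sigmaFinite_restrict_iUnion {Ω : Type*} [MeasurableSpace Ω] {μ : Measure Ω}
    {D : ℕ → Set Ω} (hD : ∀ n, MeasurableSet (D n)) (hfin : ∀ n, μ (D n) < ⊤) :
    SigmaFinite (μ.restrict (⋃ n, D n)) := by
  refine ⟨⟨⟨fun n => D n ∪ (⋃ n, D n)ᶜ, fun _ => trivial, fun n => ?_, ?_⟩⟩⟩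
  · rw [Measure.restrict_apply ((hD n).union (MeasurableSet.iUnion hD).compl),
      union_inter_distrib_right, compl_inter_self, union_empty]
    exact (measure_mono inter_subset_left).trans_lt (hfin n)
  · rw [← iUnion_union]
    exact union_compl_self _

/-- On the part of `A` of `σ`-finite measure, an essential supremum function of the restricted
conjugates is the limit of an increasing sequence `⟨v, w k⟩ - f(·, w k)` with strongly measurable
`w k`, and it vanishes on the remaining part, which consists of atoms of infinite measure. In
particular, it is the conjugate of the restriction of `f` to a single separable set. -/
theorem IsPaired.exists_approximation [CompleteSpace X] (h : IsPaired μ R f v) {u : Ω → X}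
    (hu : u ∈ R) (hfu : integralFunctional μ f u ≠ ⊤) {A : Set Ω} (hA : IsAtomSigmaFinite μ A) :
    ∃ (D : ℕ → Set Ω) (w : ℕ → Ω → X) (α : Ω → EReal), (∀ n, MeasurableSet (D n)) ∧ Monotone D ∧
      (∀ n, μ (D n) < ⊤) ∧ (⋃ n, D n) ⊆ A ∧ (∀ k, StronglyMeasurable (w k)) ∧
      (∀ᵐ ω ∂(μ.restrict (⋃ n, D n)), Monotone fun k => fenchelTerm f v (w k) ω) ∧
      (∀ ω ∈ ⋃ n, D n, α ω = ⨆ k, fenchelTerm f v (w k) ω) ∧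
      (∀ᵐ ω ∂(μ.restrict A), ω ∉ (⋃ n, D n) → fenchelTerm f v u ω = 0 ∧ α ω = 0) ∧
      IsConjEssSup μ f v A α ∧
      ∃ W : Set X, TopologicalSpace.IsSeparable W ∧
        ∀ᵐ ω ∂(μ.restrict A), α ω ≤ conjOn (f ω) W (v ω) := by
  classical
  obtain ⟨D, hDm, hDmono, hDfin, hDA, hDp⟩ := hA.exists_decomposition
  let E : Set Ω := ⋃ n, D n
  have hEm : MeasurableSet E := MeasurableSet.iUnion hDm
  have hE : IsAtomSigmaFinite μ E :=
    IsAtomSigmaFinite.iUnion fun n => isAtomSigmaFinite_of_measure_lt_top (hDm n) (hDfin n)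
  have hσ : SigmaFinite (μ.restrict E) := sigmaFinite_restrict_iUnion hDm hDfin
  have hsub : ∀ (w : {w : Ω → X // StronglyMeasurable w}) (A : Set Ω),
      StronglyMeasurable fun ω : A => w.1 ω :=
    fun w A => w.2.comp_measurable measurable_subtype_coe
  have hm : ∀ (w : {w : Ω → X // StronglyMeasurable w}) {A : Set Ω}, IsAtomSigmaFinite μ A →
      AEMeasurable (fenchelTerm f v w.1) (μ.restrict A) := fun w A hA =>
    aemeasurable_restrict_of_measurable_subtype hA.measurableSet
      (measurable_fenchelTerm h.integrand h.weakStar hA (hsub w A))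
  -- The pointwise better one of two strongly measurable functions is strongly measurable on `E`.
  have hdir : ∀ w₁ w₂ : {w : Ω → X // StronglyMeasurable w},
      ∃ w₃ : {w : Ω → X // StronglyMeasurable w}, ∀ᵐ ω ∂(μ.restrict E),
        fenchelTerm f v w₁.1 ω ≤ fenchelTerm f v w₃.1 ω ∧
          fenchelTerm f v w₂.1 ω ≤ fenchelTerm f v w₃.1 ω := fun w₁ w₂ => by
    let G : Set Ω := Subtype.val '' {ω : E | fenchelTerm f v w₂.1 ω ≤ fenchelTerm f v w₁.1 ω}
    have hG : MeasurableSet G := hEm.subtype_image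
      (measurableSet_le (measurable_fenchelTerm h.integrand h.weakStar hE (hsub w₂ E))
        (measurable_fenchelTerm h.integrand h.weakStar hE (hsub w₁ E)))
    refine ⟨⟨G.piecewise w₁.1 w₂.1, StronglyMeasurable.piecewise hG w₁.2 w₂.2⟩, ?_⟩
    filter_upwards [ae_restrict_mem hEm] with ω hω
    by_cases hGω : ω ∈ G
    · have h1 : fenchelTerm f v (G.piecewise w₁.1 w₂.1) ω = fenchelTerm f v w₁.1 ω := by
        simp only [fenchelTerm, piecewise_eq_of_mem _ _ _ hGω]
      rw [h1]
      obtain ⟨⟨ω', _⟩, h2, rfl⟩ := hGω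
      exact ⟨le_rfl, h2⟩
    · have h1 : fenchelTerm f v (G.piecewise w₁.1 w₂.1) ω = fenchelTerm f v w₂.1 ω := by
        simp only [fenchelTerm, piecewise_eq_of_notMem _ _ _ hGω]
      rw [h1]
      refine ⟨le_of_not_ge fun h2 => hGω ⟨⟨ω, hω⟩, h2, rfl⟩, le_rfl⟩
  have : Nonempty {w : Ω → X // StronglyMeasurable w} := ⟨⟨fun _ => 0, stronglyMeasurable_const⟩⟩
  obtain ⟨w, hwmono, hwsup⟩ := exists_monotone_seq_ae_le_iSup (μ.restrict E) (fun w => hm w hE) hdir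
  -- Outside `E` there are only atoms of infinite measure, where the value must be zero.
  let α : Ω → EReal := E.indicator fun ω => ⨆ k, fenchelTerm f v (w k).1 ω
  have hαE : ∀ ω ∈ E, α ω = ⨆ k, fenchelTerm f v (w k).1 ω := fun ω hω => indicator_of_mem hω _
  have hαE' : ∀ ω ∉ E, α ω = 0 := fun ω hω => indicator_of_notMem hω _
  have hαm : AEMeasurable α (μ.restrict A) :=
    (AEMeasurable.iSup fun k => hm (w k) hA).indicator hEm
  have hatom : ∀ B, IsMeasureAtom μ B → μ B = ⊤ → ∀ᵐ ω ∂(μ.restrict B), α ω = 0 :=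
    fun B hB hμB => by
      filter_upwards [ae_all_iff.2 fun n => hB.ae_notMem_of_measure_lt_top hμB (hDm n) (hDfin n)]
        with ω hω
      exact hαE' ω (by simpa [E] using hω)
  let W : Set X := (⋃ k, range (w k).1) ∪ range fun ω : A => u ω
  have hW : TopologicalSpace.IsSeparable W :=
    (TopologicalSpace.IsSeparable.iUnion fun k => (w k).2.isSeparable_range).union
      (h.stronglyMeasurable u hu A hA).isSeparable_range
  have hαW : ∀ᵐ ω ∂(μ.restrict A), α ω ≤ conjOn (f ω) W (v ω) := by
    refine hDp _ ?_ fun B hBA hB hμB => ?_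
    · filter_upwards [ae_restrict_mem hEm] with ω hω
      rw [hαE ω hω]
      exact iSup_le fun k => fenchelTerm_le_conjOn
        (.inl (mem_iUnion.2 ⟨k, mem_range_self ω⟩))
    · filter_upwards [hatom B hB hμB, h.fenchelTerm_ae_eq_zero hu hfu hB hμB,
        ae_restrict_mem hB.1] with ω h1 h2 h3
      rw [h1, ← h2]
      exact fenchelTerm_le_conjOn (.inr ⟨⟨ω, hBA h3⟩, rfl⟩)
  refine ⟨D, fun k => (w k).1, α, hDm, hDmono, hDfin, hDA, fun k => (w k).2, hwmono, hαE, ?_,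
    ⟨hαm, fun W' => ?_, fun β _ hβ => ?_⟩, W, hW, hαW⟩
  · refine hDp _ ?_ fun B _ hB hμB => ?_
    · filter_upwards [ae_restrict_mem hEm] with ω hω hω'
      exact absurd hω hω'
    · filter_upwards [hatom B hB hμB, h.fenchelTerm_ae_eq_zero hu hfu hB hμB] with ω h1 h2 _
      exact ⟨h2, h1⟩
  · refine hDp _ ?_ fun B _ hB hμB => ?_
    · refine ae_conjOn_le_of_forall_fenchelTerm_le h.integrand h.weakStar hE
        (hαm.mono_measure (Measure.restrict_mono hDA le_rfl)) (fun w' hw' => ?_) W'.2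
      filter_upwards [hwsup ⟨w', hw'⟩, ae_restrict_mem hEm] with ω h1 h2
      rwa [hαE ω h2]
    · filter_upwards [hatom B hB hμB, h.conjOn_nonpos B hB hμB W'.1 W'.2] with ω h1 h2
      rwa [h1]
  · filter_upwards [hαW, hβ ⟨W, hW⟩] with ω h1 h2
    exact h1.trans h2

theorem IsPaired.exists_isConjEssSup [CompleteSpace X] (h : IsPaired μ R f v)
    (hdom : ∃ u ∈ R, integralFunctional μ f u ≠ ⊤) {A : Set Ω} (hA : IsAtomSigmaFinite μ A) :
    ∃ α, IsConjEssSup μ f v A α := by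
  obtain ⟨u, hu, hfu⟩ := hdom
  obtain ⟨D, w, α, -, -, -, -, -, -, -, -, hα, -⟩ := h.exists_approximation hu hfu hA
  exact ⟨α, hα⟩

/-- The essential supremum of the conjugates over all separable sets is attained. -/
theorem IsPaired.exists_isSeparable_eq [CompleteSpace X] (h : IsPaired μ R f v)
    (hdom : ∃ u ∈ R, integralFunctional μ f u ≠ ⊤) {A : Set Ω} (hA : IsAtomSigmaFinite μ A)
    {α : Ω → EReal} (hα : IsConjEssSup μ f v A α) :
    ∃ W : Set X, TopologicalSpace.IsSeparable W ∧
      ∀ᵐ ω ∂(μ.restrict A), α ω = conjOn (f ω) W (v ω) := by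
  obtain ⟨u, hu, hfu⟩ := hdom
  obtain ⟨D, w, α', -, -, -, -, -, -, -, -, hα', W, hW, hle⟩ := h.exists_approximation hu hfu hA
  refine ⟨W, hW, ?_⟩
  filter_upwards [hα.ae_unique hα', hle, hα.conjOn_le hW] with ω h1 h2 h3
  exact le_antisymm (h1.trans_le h2) h3

theorem IsPaired.isConsistent_of_isConjEssSup [CompleteSpace X] (h : IsPaired μ R f v)
    (hdom : ∃ u ∈ R, integralFunctional μ f u ≠ ⊤) {α : Set Ω → Ω → EReal}
    (hα : ∀ A, IsAtomSigmaFinite μ A → IsConjEssSup μ f v A (α A)) : IsConsistent μ α := by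
  refine ⟨fun A hA => (hα A hA).1, fun A B hA hB hAB => ?_⟩
  obtain ⟨W, hW, hWA⟩ := h.exists_isSeparable_eq hdom hA (hα A hA)
  obtain ⟨W', hW', hWB⟩ := h.exists_isSeparable_eq hdom hB (hα B hB)
  filter_upwards [hWA, ae_restrict_of_ae_restrict_of_subset hAB hWB, (hα A hA).conjOn_le hW',
    ae_restrict_of_ae_restrict_of_subset hAB ((hα B hB).conjOn_le hW)] with ω h1 h2 h3 h4
  exact le_antisymm (h1.trans_le h4) (h2.trans_le h3)

/-! ### The conjugate of the integral functional -/

theorem exists_pos_forall_lt_setLIntegral {Ω : Type*} [MeasurableSpace Ω] {μ : Measure Ω}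
    {F : Set Ω} {φ : Ω → ENNReal}
    (hφ : AEMeasurable φ (μ.restrict F)) {c : ENNReal} (hc : c < ∫⁻ ω in F, φ ω ∂μ) :
    ∃ δ : ENNReal, 0 < δ ∧ ∀ G ⊆ F, MeasurableSet G → μ (F \ G) < δ → c < ∫⁻ ω in G, φ ω ∂μ := by
  -- Truncation makes the integral over `F \ G` small.
  obtain ⟨m, hm⟩ : ∃ m : ℕ, c < ∫⁻ ω in F, min (φ ω) m ∂μ := by
    have h1 : ∀ ω, φ ω = ⨆ m : ℕ, min (φ ω) m := fun ω => by
      rw [← inf_iSup_eq, ENNReal.iSup_natCast, inf_top_eq]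
    rw [lintegral_congr h1, lintegral_iSup' (fun m => hφ.min aemeasurable_const)
      (ae_of_all _ fun ω m m' hmm' =>
        min_le_min_left _ (by exact_mod_cast hmm'))] at hc
    exact lt_iSup_iff.1 hc
  have hc' : c ≠ ⊤ := hm.ne_top
  refine ⟨(∫⁻ ω in F, min (φ ω) m ∂μ - c) / (m + 1), ?_, fun G hGF hG hδ => ?_⟩
  · exact ENNReal.div_pos (tsub_pos_of_lt hm).ne' (by simp)
  · by_contra hle
    rw [not_lt] at hle
    have h1 : ∫⁻ ω in F, min (φ ω) m ∂μ ≤ c + (m + 1) * μ (F \ G) := by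
      conv_lhs => rw [← union_sdiff_cancel hGF]
      refine (lintegral_union_le _ _ _).trans (add_le_add ?_ ?_)
      · exact (lintegral_mono fun ω => min_le_left _ _).trans hle
      · refine (lintegral_mono (g := fun _ => (m + 1 : ENNReal)) fun ω =>
          (min_le_right _ _).trans le_self_add).trans ?_
        simp
    rw [ENNReal.lt_div_iff_mul_lt (by simp) (by simp), mul_comm] at hδ
    have h2 := h1.trans_lt (ENNReal.add_lt_add_left hc' hδ)
    rw [add_tsub_cancel_of_le hm.le] at h2
    exact lt_irrefl _ h2

theorem exhIntegralFamily_ne_top_of_exhPos_ne_top {α : Set Ω → Ω → EReal}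
    (h : exhPos μ α ≠ ⊤) : exhIntegralFamily μ α ≠ ⊤ := by
  rw [exhIntegralFamily, if_neg h]
  lift exhPos μ α to NNReal using h with P
  generalize exhPos μ (fun A ω => -α A ω) = N
  rw [EReal.coe_nnreal_eq_coe_real]
  cases N with
  | top => simp
  | coe N =>
    rw [EReal.coe_nnreal_eq_coe_real, ← EReal.coe_sub]
    exact EReal.coe_ne_top _

theorem IsPaired.integralFunctional_ne_top_of_fenchelTerm_le (h : IsPaired μ R f v) {u w : Ω → X}
    (hw : w ∈ R) (hle : ∀ ω, fenchelTerm f v u ω ≤ fenchelTerm f v w ω)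
    (hN : exhPos μ (fun _ ω => -fenchelTerm f v u ω) ≠ ⊤) : integralFunctional μ f w ≠ ⊤ := by
  refine exhIntegralFamily_ne_top_of_exhPos_ne_top ?_
  refine ne_top_of_le_ne_top (ENNReal.add_ne_top.2 ⟨h.exhPos_apply_ne_top hw, hN⟩)
    ((exhPos_le_exhPos_add_exhPos_neg_sub (h.isConsistent_apply hw)
      (h.isConsistent_integrand hw)).trans (add_le_add le_rfl ?_))
  exact exhPos_mono fun A _ => ae_of_all _ fun ω => EReal.neg_le_neg_iff.2 (hle ω)

/-- The integral of the excess of the essential supremum over `⟨v, u⟩ - f(·, u)` is approximated by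
modifications of `u` inside `R`: almost decomposability is applied to a bounded piece of a strongly
measurable function that nearly attains the supremum. -/
theorem IsPaired.exists_mem_lt_exhPos_sub [CompleteSpace X] (h : IsPaired μ R f v) {u : Ω → X}
    (hu : u ∈ R) (hfu : integralFunctional μ f u ≠ ⊤)
    (hreal : ∀ A, IsAtomSigmaFinite μ A →
      ∀ᵐ ω ∂(μ.restrict A), fenchelTerm f v u ω ≠ ⊥ ∧ fenchelTerm f v u ω ≠ ⊤)
    {A : Set Ω} (hA : IsAtomSigmaFinite μ A) {α : Ω → EReal} (hα : IsConjEssSup μ f v A α)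
    {c : ENNReal} (hc : c < ∫⁻ ω in A, (α ω - fenchelTerm f v u ω).toENNReal ∂μ) :
    ∃ z ∈ R, (∀ ω, fenchelTerm f v u ω ≤ fenchelTerm f v z ω) ∧
      c < exhPos μ fun _ ω => fenchelTerm f v z ω - fenchelTerm f v u ω := by
  classical
  obtain ⟨D, w, α', hDm, hDmono, hDfin, hDA, hw, hwmono, hαD, hαD', hα', -⟩ :=
    h.exists_approximation hu hfu hA
  let E : Set Ω := ⋃ n, D n
  have hEm : MeasurableSet E := MeasurableSet.iUnion hDm
  have hE : IsAtomSigmaFinite μ E :=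
    IsAtomSigmaFinite.iUnion fun n => isAtomSigmaFinite_of_measure_lt_top (hDm n) (hDfin n)
  have hsub : ∀ k, StronglyMeasurable fun ω : E => w k ω :=
    fun k => (hw k).comp_measurable measurable_subtype_coe
  have hmw : ∀ k, Measurable fun ω : E => fenchelTerm f v (w k) ω := fun k =>
    measurable_fenchelTerm h.integrand h.weakStar hE (hsub k)
  have hmu : Measurable fun ω : E => fenchelTerm f v u ω :=
    measurable_fenchelTerm h.integrand h.weakStar hE (h.stronglyMeasurable u hu E hE)
  let φ : ℕ → Ω → ENNReal := fun k ω => (fenchelTerm f v (w k) ω - fenchelTerm f v u ω).toENNReal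
  have hφm : ∀ k, AEMeasurable (φ k) (μ.restrict E) := fun k =>
    aemeasurable_restrict_of_measurable_subtype hEm
      (measurable_ereal_sub.comp ((hmw k).prodMk hmu)).ereal_toENNReal
  have h1 : c < ∫⁻ ω in E, ⨆ k, φ k ω ∂μ := by
    refine hc.trans_le ?_
    have h2 : ∫⁻ ω in A, (α ω - fenchelTerm f v u ω).toENNReal ∂μ ≤
        ∫⁻ ω in A, E.indicator (fun ω => ⨆ k, φ k ω) ω ∂μ := by
      refine lintegral_mono_ae ?_
      filter_upwards [hα.ae_unique hα', hαD', hreal A hA] with ω h2 h3 h4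
      rw [h2]
      by_cases hω : ω ∈ E
      · rw [indicator_of_mem hω, hαD ω hω]
        lift fenchelTerm f v u ω to ℝ using ⟨h4.2, h4.1⟩ with r hr
        rw [← EReal.toENNReal_coe (x := ⨆ k, φ k ω)]
        refine EReal.toENNReal_le_toENNReal ?_
        rw [EReal.sub_le_iff_le_add (.inl (EReal.coe_ne_bot r)) (.inl (EReal.coe_ne_top r))]
        refine iSup_le fun k => ?_
        rw [← EReal.sub_le_iff_le_add (.inl (EReal.coe_ne_bot r)) (.inl (EReal.coe_ne_top r))]
        refine le_trans ?_ (EReal.coe_ennreal_le_coe_ennreal_iff.2 (le_iSup (fun k => φ k ω) k))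
        simp only [φ, ← hr]
        rw [EReal.coe_toENNReal_eq_max]
        exact le_max_right _ _
      · obtain ⟨h5, h6⟩ := h3 hω
        simp [h5, h6]
    refine h2.trans_eq ?_
    rw [lintegral_indicator hEm, Measure.restrict_restrict hEm, inter_eq_left.2 hDA]
  rw [lintegral_iSup' hφm] at h1
  swap
  · filter_upwards [hwmono] with ω hω k k' hk
    exact EReal.toENNReal_le_toENNReal (EReal.sub_le_sub (hω hk) le_rfl)
  obtain ⟨k, hk⟩ := lt_iSup_iff.1 h1
  let P : Set Ω := Subtype.val '' {ω : E | fenchelTerm f v u ω ≤ fenchelTerm f v (w k) ω}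
  have hP : MeasurableSet P := hEm.subtype_image (measurableSet_le hmu (hmw k))
  -- Only the part where `w k` improves on `u` counts; it is exhausted by sets of finite measure on
  -- which `w k` is bounded.
  let F : ℕ → Set Ω := fun n => D n ∩ {ω | ‖w k ω‖ ≤ n} ∩ P
  have hFm : ∀ n, MeasurableSet (F n) := fun n =>
    ((hDm n).inter (measurableSet_le (hw k).norm.measurable measurable_const)).inter hP
  have hFmono : Monotone F := fun n n' hn => by
    refine inter_subset_inter_left _ (inter_subset_inter (hDmono hn) fun ω hω => ?_)
    have h3 : ‖w k ω‖ ≤ n := hω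
    exact h3.trans (by exact_mod_cast hn)
  have hFE : ∀ n, F n ⊆ E := fun n ω hω => mem_iUnion.2 ⟨n, hω.1.1⟩
  have h3 : c < ∫⁻ ω in ⋃ n, F n, φ k ω ∂μ := by
    refine hk.trans_le ?_
    have h4 : ∫⁻ ω in E, φ k ω ∂μ ≤ ∫⁻ ω in E, (⋃ n, F n).indicator (φ k) ω ∂μ := by
      refine setLIntegral_mono' hEm fun ω hω => ?_
      by_cases hωF : ω ∈ ⋃ n, F n
      · rw [indicator_of_mem hωF]
      · have hωP : ω ∉ P := fun hωP => by
          obtain ⟨n, hn⟩ := mem_iUnion.1 hω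
          obtain ⟨n', hn'⟩ := exists_nat_ge ‖w k ω‖
          refine hωF (mem_iUnion.2 ⟨max n n', ⟨hDmono (le_max_left _ _) hn, ?_⟩, hωP⟩)
          exact hn'.trans (by exact_mod_cast le_max_right n n')
        have : φ k ω = 0 := by
          refine EReal.toENNReal_of_nonpos (EReal.sub_nonpos.2 (le_of_not_ge fun h5 => hωP ?_))
          exact ⟨⟨ω, hω⟩, h5, rfl⟩
        rw [this]
        exact zero_le
    refine h4.trans_eq ?_
    rw [lintegral_indicator (MeasurableSet.iUnion hFm),
      Measure.restrict_restrict (MeasurableSet.iUnion hFm), inter_eq_left.2 (iUnion_subset hFE)]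
  rw [setLIntegral_iUnion_of_directed _ hFmono.directed_le] at h3
  obtain ⟨n, hn⟩ := lt_iSup_iff.1 h3
  have hμF : μ (F n) < ⊤ :=
    (measure_mono (inter_subset_left.trans inter_subset_left)).trans_lt (hDfin n)
  obtain ⟨δ, hδ, hδG⟩ := exists_pos_forall_lt_setLIntegral
    ((hφm k).mono_measure (Measure.restrict_mono (hFE n) le_rfl)) hn
  obtain ⟨G, hG, hGF, hGδ, hGR⟩ := h.decomposable u hu (F n) (hFm n) hμF δ hδ (w k) (hw k)
    ⟨n, fun ω hω => hω.1.2⟩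
  have hzG : ∀ ω ∈ G, fenchelTerm f v (G.piecewise (w k) u) ω = fenchelTerm f v (w k) ω :=
    fun ω hω => by simp only [fenchelTerm, piecewise_eq_of_mem _ _ _ hω]
  have hzG' : ∀ ω ∉ G, fenchelTerm f v (G.piecewise (w k) u) ω = fenchelTerm f v u ω :=
    fun ω hω => by simp only [fenchelTerm, piecewise_eq_of_notMem _ _ _ hω]
  refine ⟨G.piecewise (w k) u, hGR, fun ω => ?_, ?_⟩
  · by_cases hω : ω ∈ G
    · rw [hzG ω hω]
      obtain ⟨⟨ω', _⟩, h5, rfl⟩ := (hGF hω).2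
      exact h5
    · exact (hzG' ω hω).ge
  · refine (hδG G hGF hG hGδ).trans_le ?_
    have h5 : ∫⁻ ω in G, φ k ω ∂μ = ∫⁻ ω in G,
        (fenchelTerm f v (G.piecewise (w k) u) ω - fenchelTerm f v u ω).toENNReal ∂μ :=
      setLIntegral_congr_fun hG fun ω hω => by simp only [φ, hzG ω hω]
    rw [h5]
    exact setLIntegral_le_exhLIntegral (fun _ ω =>
      (fenchelTerm f v (G.piecewise (w k) u) ω - fenchelTerm f v u ω).toENNReal)
      (isAtomSigmaFinite_of_measure_lt_top hG ((measure_mono hGF).trans_lt hμF))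

/-- The conjugate of the integral functional is the exhausting integral of the essential suprema of
the restricted conjugates. -/
theorem IsPaired.integralConjugate_eq [CompleteSpace X] (h : IsPaired μ R f v)
    (hdom : ∃ u ∈ R, integralFunctional μ f u ≠ ⊤) {α : Set Ω → Ω → EReal}
    (hα : ∀ A, IsAtomSigmaFinite μ A → IsConjEssSup μ f v A (α A)) :
    integralConjugate μ R f v = exhIntegralFamily μ α := by
  have hle : ∀ u ∈ R, ∀ A, IsAtomSigmaFinite μ A →
      ∀ᵐ ω ∂(μ.restrict A), fenchelTerm f v u ω ≤ α A ω := fun u hu A hA =>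
    h.fenchelTerm_le_of_isConjEssSup hu hA (hα A hA)
  have hcons := h.isConsistent_of_isConjEssSup hdom hα
  refine le_antisymm (iSup₂_le fun u hu => ?_) ?_
  · by_cases hfu : integralFunctional μ f u = ⊤
    · rw [hfu, EReal.sub_top]
      exact bot_le
    · rw [h.pairing_sub_integralFunctional hu hfu]
      exact exhIntegralFamily_mono (hle u hu)
  · obtain ⟨u, hu, hfu⟩ := hdom
    by_cases htop : exhIntegral μ (fenchelTerm f v u) = ⊤
    · have := h.exhIntegral_fenchelTerm_le hu hfu
      rw [htop, top_le_iff] at this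
      rw [this]
      exact le_top
    have hbot := h.exhIntegral_fenchelTerm_ne_bot hu hfu
    have hcu := h.isConsistent_fenchelTerm hu
    have hreal : ∀ A, IsAtomSigmaFinite μ A →
        ∀ᵐ ω ∂(μ.restrict A), fenchelTerm f v u ω ≠ ⊥ ∧ fenchelTerm f v u ω ≠ ⊤ :=
      fun A hA => ae_real_of_exhIntegralFamily hcu hbot htop hA
    have hN := exhPos_neg_ne_top_of_exhIntegralFamily_ne_bot hbot htop
    rw [exhIntegralFamily_eq_add_exhPos_sub hcons hcu (hle u hu) hbot htop]
    change exhIntegral μ (fenchelTerm f v u) + _ ≤ _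
    have hz : ∀ z ∈ R, (∀ ω, fenchelTerm f v u ω ≤ fenchelTerm f v z ω) →
        exhIntegral μ (fenchelTerm f v u) +
          (exhPos μ (fun _ ω => fenchelTerm f v z ω - fenchelTerm f v u ω) : EReal) ≤
          integralConjugate μ R f v := fun z hz hz' => by
      refine le_trans (le_of_eq ?_)
        (h.exhIntegral_fenchelTerm_le hz (h.integralFunctional_ne_top_of_fenchelTerm_le hz hz' hN))
      exact (exhIntegralFamily_eq_add_exhPos_sub (h.isConsistent_fenchelTerm hz) hcu
        (fun A _ => ae_of_all _ hz') hbot htop).symm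
    have hr := h.exhIntegral_fenchelTerm_le hu hfu
    generalize integralConjugate μ R f v = T at *
    lift exhIntegral μ (fenchelTerm f v u) to ℝ using ⟨htop, hbot⟩ with r
    have key : exhPos μ (fun A ω => α A ω - fenchelTerm f v u ω) ≤ (T - r).toENNReal := by
      refine le_of_forall_lt fun c hc => ?_
      obtain ⟨A, hcA⟩ := lt_iSup_iff.1 hc
      obtain ⟨hA, hcA⟩ := lt_iSup_iff.1 hcA
      obtain ⟨z, hzR, hz', hcz⟩ := h.exists_mem_lt_exhPos_sub hu hfu hreal hA (hα A hA) hcA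
      refine hcz.trans_le ?_
      have h3 := hz z hzR hz'
      rw [← EReal.toENNReal_coe (x := exhPos μ _)]
      refine EReal.toENNReal_le_toENNReal ?_
      rw [EReal.le_sub_iff_add_le (.inl (EReal.coe_ne_bot r)) (.inl (EReal.coe_ne_top r)), add_comm]
      exact h3
    have h4 : 0 ≤ T - r :=
      (EReal.sub_nonneg (.inr (EReal.coe_ne_top r)) (.inr (EReal.coe_ne_bot r))).2 hr
    have h5 := EReal.coe_ennreal_le_coe_ennreal_iff.2 key
    rw [EReal.coe_toENNReal h4,
      EReal.le_sub_iff_add_le (.inl (EReal.coe_ne_bot r)) (.inl (EReal.coe_ne_top r)),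
      add_comm] at h5
    exact h5

end Paired

/-! ### The subdifferential of the integral functional -/

theorem isSubgradientOn_iff {X : Type*} [NormedAddCommGroup X] [NormedSpace ℝ X] {h : X → EReal}
    {W : Set X} {x₀ : X} {ξ : StrongDual ℝ X} (hbot : h x₀ ≠ ⊥) (htop : h x₀ ≠ ⊤) :
    IsSubgradientOn h W x₀ ξ ↔ x₀ ∈ W ∧ conjOn h W ξ ≤ ((ξ x₀ : ℝ) : EReal) - h x₀ := by
  have key : ∀ x, h x₀ + ((ξ (x - x₀) : ℝ) : EReal) ≤ h x ↔
      ((ξ x : ℝ) : EReal) - h x ≤ ((ξ x₀ : ℝ) : EReal) - h x₀ := fun x => by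
    rw [map_sub]
    lift h x₀ to ℝ using ⟨htop, hbot⟩ with q
    generalize h x = t
    induction t with
    | bot =>
      rw [EReal.coe_sub_bot, ← EReal.coe_sub, ← EReal.coe_add, top_le_iff, le_bot_iff]
      exact iff_of_false (EReal.coe_ne_bot _) (EReal.coe_ne_top _)
    | top => simp
    | coe t =>
      norm_cast
      constructor <;> intro h <;> linarith
  simp only [IsSubgradientOn, conjOn, iSup₂_le_iff, key, ne_eq, hbot, htop, not_false_eq_true,
    true_and]

theorem conjOn_le_of_isSubgradientOn {X : Type*} [NormedAddCommGroup X] [NormedSpace ℝ X]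
    {h : X → EReal} {W : Set X} {x₀ : X} {ξ : StrongDual ℝ X} (hsub : IsSubgradientOn h W x₀ ξ) :
    conjOn h W ξ ≤ ((ξ x₀ : ℝ) : EReal) - h x₀ :=
  ((isSubgradientOn_iff hsub.2.1 hsub.2.2.1).1 hsub).2

theorem coe_add_coe_ennreal_le_iff {r : ℝ} {D : ENNReal} :
    (r : EReal) + (D : EReal) ≤ r ↔ D = 0 := by
  cases D with
  | top => simp
  | coe D =>
    rw [EReal.coe_nnreal_eq_coe_real]
    norm_cast
    constructor
    · intro h
      exact NNReal.coe_eq_zero.1 (le_antisymm (by linarith) D.2)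
    · rintro rfl
      simp

section Exhausting

variable {Ω : Type*} [MeasurableSpace Ω] {μ : Measure Ω}

theorem ae_nonpos_of_exhPos_eq_zero {α : Set Ω → Ω → EReal} (hα : IsConsistent μ α)
    (h : exhPos μ α = 0) {A : Set Ω} (hA : IsAtomSigmaFinite μ A) :
    ∀ᵐ ω ∂(μ.restrict A), α A ω ≤ 0 := by
  have h1 : ∫⁻ ω in A, (α A ω).toENNReal ∂μ = 0 :=
    nonpos_iff_eq_zero.1
      ((setLIntegral_le_exhLIntegral (fun A ω => (α A ω).toENNReal) hA).trans_eq h)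
  rw [lintegral_eq_zero_iff' (hα.1 A hA).ereal_toENNReal] at h1
  exact h1.mono fun ω h => EReal.toENNReal_eq_zero_iff.1 h

/-- A function with finite exhausting integral vanishes outside a single countable union of atoms
and sets of finite measure. -/
theorem exists_ae_eq_zero_of_exhLIntegral_ne_top {g : Ω → ENNReal}
    (hg : ∀ A, IsAtomSigmaFinite μ A → AEMeasurable g (μ.restrict A))
    (hfin : exhLIntegral μ (fun _ => g) ≠ ⊤) :
    ∃ A₀, IsAtomSigmaFinite μ A₀ ∧ ∀ A, IsAtomSigmaFinite μ A →
      ∀ᵐ ω ∂(μ.restrict A), ω ∉ A₀ → g ω = 0 := by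
  let J : {A : Set Ω // IsAtomSigmaFinite μ A} → ENNReal := fun A => ∫⁻ ω in A.1, g ω ∂μ
  have hJ : exhLIntegral μ (fun _ => g) = sSup (range J) := by
    rw [exhLIntegral, iSup_subtype', sSup_range]
  have hne : (range J).Nonempty :=
    ⟨_, ⟨⟨∅, isAtomSigmaFinite_of_measure_lt_top MeasurableSet.empty (by simp)⟩, rfl⟩⟩
  obtain ⟨y, -, hy, hyJ⟩ := exists_seq_tendsto_sSup hne (OrderTop.bddAbove _)
  choose B hB using hyJ
  have hA₀ : IsAtomSigmaFinite μ (⋃ n, (B n).1) := IsAtomSigmaFinite.iUnion fun n => (B n).2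
  have hle : exhLIntegral μ (fun _ => g) ≤ ∫⁻ ω in ⋃ n, (B n).1, g ω ∂μ := by
    rw [hJ]
    refine le_of_tendsto' hy fun n => ?_
    rw [← hB n]
    exact lintegral_mono_set (subset_iUnion (fun n => (B n).1) n)
  refine ⟨_, hA₀, fun A hA => ?_⟩
  have hdiff : MeasurableSet (A \ ⋃ n, (B n).1) := hA.measurableSet.diff hA₀.measurableSet
  have h0 : ∫⁻ ω in A \ ⋃ n, (B n).1, g ω ∂μ = 0 := by
    have h1 := setLIntegral_le_exhLIntegral (fun _ => g) (hA₀.union hA)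
    rw [← union_sdiff_self, lintegral_union hdiff disjoint_sdiff_right] at h1
    have h2 := h1.trans hle
    have h3 : ∫⁻ ω in ⋃ n, (B n).1, g ω ∂μ ≠ ⊤ :=
      ne_top_of_le_ne_top hfin (setLIntegral_le_exhLIntegral (fun _ => g) hA₀)
    conv_rhs at h2 => rw [← add_zero (∫⁻ ω in ⋃ n, (B n).1, g ω ∂μ)]
    exact nonpos_iff_eq_zero.1 ((ENNReal.add_le_add_iff_left h3).1 h2)
  rw [lintegral_eq_zero_iff' ((hg A hA).mono_measure (Measure.restrict_mono sdiff_subset le_rfl)),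
    Filter.EventuallyEq, ae_restrict_iff' hdiff] at h0
  rw [ae_restrict_iff' hA.measurableSet]
  filter_upwards [h0] with ω h1 h2 h3
  exact h1 ⟨h2, h3⟩

end Exhausting

section Paired

variable {Ω X : Type*} [MeasurableSpace Ω] [NormedAddCommGroup X] [NormedSpace ℝ X]
  [MeasurableSpace X] [BorelSpace X] {μ : Measure Ω} {f : Ω → X → EReal}
  {v : Ω → StrongDual ℝ X}

theorem IsPaired.pairing_sub {R : Set (Ω → X)} (h : IsPaired μ R f v) {u w : Ω → X} (hu : u ∈ R)
    (hw : w ∈ R) : pairing μ (w - u) v = pairing μ w v - pairing μ u v := by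
  refine Eq.trans ?_ (exhIntegral_sub (h.isConsistent_apply hw) (h.isConsistent_apply hu)
    (h.exhPos_apply_ne_top hw) (h.exhPos_neg_apply_ne_top hw) (h.exhPos_apply_ne_top hu))
  simp only [pairing, exhIntegral, Pi.sub_apply, map_sub, EReal.coe_sub]

theorem IsPaired.ae_integrand_real {R : Set (Ω → X)} (h : IsPaired μ R f v) {u : Ω → X}
    (hu : u ∈ R) (hbot : integralFunctional μ f u ≠ ⊥) (htop : integralFunctional μ f u ≠ ⊤)
    {A : Set Ω} (hA : IsAtomSigmaFinite μ A) :
    ∀ᵐ ω ∂(μ.restrict A), f ω (u ω) ≠ ⊥ ∧ f ω (u ω) ≠ ⊤ :=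
  ae_real_of_exhIntegralFamily (h.isConsistent_integrand hu) hbot htop hA

/-- The subdifferential is characterized by equality in the Fenchel-Young inequality, which, in view
of the integral formula for the conjugate, is a pointwise condition. -/
theorem IsPaired.mem_integralSubdifferential_iff [CompleteSpace X] {R : Set (Ω → X)}
    (h : IsPaired μ R f v) {S : Set (Ω → StrongDual ℝ X)} (hv : v ∈ S) {u : Ω → X} (hu : u ∈ R)
    (hbot : integralFunctional μ f u ≠ ⊥) (htop : integralFunctional μ f u ≠ ⊤) :
    v ∈ integralSubdifferential μ R S f u ↔ ∀ A, IsAtomSigmaFinite μ A →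
      ∀ W : Set X, TopologicalSpace.IsSeparable W →
        ∀ᵐ ω ∂(μ.restrict A), conjOn (f ω) W (v ω) ≤ fenchelTerm f v u ω := by
  have hdom : ∃ u ∈ R, integralFunctional μ f u ≠ ⊤ := ⟨u, hu, htop⟩
  choose! α hα using fun A hA => h.exists_isConjEssSup hdom (A := A) hA
  have hcu := h.isConsistent_fenchelTerm hu
  have hcα := h.isConsistent_of_isConjEssSup hdom hα
  have hterm := h.pairing_sub_integralFunctional hu htop
  have hstep1 : v ∈ integralSubdifferential μ R S f u ↔
      integralConjugate μ R f v ≤ exhIntegral μ (fenchelTerm f v u) := by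
    have key : ∀ w ∈ R, integralFunctional μ f u + pairing μ (w - u) v ≤ integralFunctional μ f w ↔
        pairing μ w v - integralFunctional μ f w ≤ exhIntegral μ (fenchelTerm f v u) :=
      fun w hw => by
        rw [h.pairing_sub hu hw, ← hterm]
        obtain ⟨h1, h2⟩ := h.pairing_real u hu
        obtain ⟨h3, h4⟩ := h.pairing_real w hw
        lift pairing μ u v to ℝ using ⟨h2, h1⟩ with p
        lift pairing μ w v to ℝ using ⟨h4, h3⟩ with p'
        lift integralFunctional μ f u to ℝ using ⟨htop, hbot⟩ with q
        generalize integralFunctional μ f w = t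
        induction t with
        | bot =>
          rw [EReal.coe_sub_bot, ← EReal.coe_sub, ← EReal.coe_sub, ← EReal.coe_add, top_le_iff,
            le_bot_iff]
          exact iff_of_false (EReal.coe_ne_bot _) (EReal.coe_ne_top _)
        | top => simp
        | coe t =>
          norm_cast
          constructor <;> intro h <;> linarith
    simp only [integralSubdifferential, mem_ofPred_eq, integralConjugate, iSup₂_le_iff]
    exact ⟨fun h1 w hw => (key w hw).1 (h1.2.2.2 w hw),
      fun h1 => ⟨hv, hbot, htop, fun w hw => (key w hw).2 (h1 w hw)⟩⟩
  have hrb := h.exhIntegral_fenchelTerm_ne_bot hu htop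
  have hrt : exhIntegral μ (fenchelTerm f v u) ≠ ⊤ := by
    rw [← hterm]
    obtain ⟨h1, h2⟩ := h.pairing_real u hu
    lift pairing μ u v to ℝ using ⟨h2, h1⟩ with p
    lift integralFunctional μ f u to ℝ using ⟨htop, hbot⟩ with q
    rw [← EReal.coe_sub]
    exact EReal.coe_ne_top _
  rw [hstep1, h.integralConjugate_eq hdom hα, exhIntegralFamily_eq_add_exhPos_sub hcα hcu
    (fun A hA => h.fenchelTerm_le_of_isConjEssSup hu hA (hα A hA)) hrb hrt]
  change exhIntegral μ (fenchelTerm f v u) + _ ≤ _ ↔ _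
  lift exhIntegral μ (fenchelTerm f v u) to ℝ using ⟨hrt, hrb⟩ with r
  rw [coe_add_coe_ennreal_le_iff]
  constructor
  · intro h0 A hA W hW
    filter_upwards [ae_nonpos_of_exhPos_eq_zero (hcα.sub hcu) h0 hA, (hα A hA).conjOn_le hW]
      with ω h1 h2
    exact h2.trans (EReal.sub_nonpos.1 h1)
  · intro h0
    have h1 : exhPos μ (fun A ω => α A ω - fenchelTerm f v u ω) ≤
        exhPos μ fun (_ : Set Ω) (_ : Ω) => 0 := by
      refine exhPos_mono fun A hA => ?_
      filter_upwards [(hα A hA).2.2 _ (hcu.1 A hA) fun W => h0 A hA W.1 W.2] with ω h2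
      exact EReal.sub_nonpos.2 h2
    simpa [exhPos] using h1

theorem IsPaired.mem_integralSubdifferential_iff_isSubgradientOn [CompleteSpace X]
    {R : Set (Ω → X)} (h : IsPaired μ R f v) {S : Set (Ω → StrongDual ℝ X)} (hv : v ∈ S)
    {u : Ω → X} (hu : u ∈ R) (hbot : integralFunctional μ f u ≠ ⊥)
    (htop : integralFunctional μ f u ≠ ⊤) :
    v ∈ integralSubdifferential μ R S f u ↔ ∀ A, IsAtomSigmaFinite μ A →
      ∀ W : Set X, TopologicalSpace.IsSeparable W → (∀ᵐ ω ∂(μ.restrict A), u ω ∈ W) →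
        ∀ᵐ ω ∂(μ.restrict A), IsSubgradientOn (f ω) W (u ω) (v ω) := by
  rw [h.mem_integralSubdifferential_iff hv hu hbot htop]
  constructor
  · intro h1 A hA W hW huW
    filter_upwards [h1 A hA W hW, huW, h.ae_integrand_real hu hbot htop hA] with ω h2 h3 h4
    exact (isSubgradientOn_iff h4.1 h4.2).2 ⟨h3, h2⟩
  · intro h1 A hA W hW
    have hW' := hW.union (h.stronglyMeasurable u hu A hA).isSeparable_range
    have hu' : ∀ᵐ ω ∂(μ.restrict A), u ω ∈ W ∪ range fun ω : A => u ω := by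
      filter_upwards [ae_restrict_mem hA.measurableSet] with ω hω
      exact .inr ⟨⟨ω, hω⟩, rfl⟩
    filter_upwards [h1 A hA _ hW' hu'] with ω h2
    exact (conjOn_mono subset_union_left _).trans (conjOn_le_of_isSubgradientOn h2)

theorem IsPaired.mem_integralSubdifferential_iff_of_mem_sepAlmostRange [CompleteSpace X]
    {R : Set (Ω → X)} (h : IsPaired μ R f v) {S : Set (Ω → StrongDual ℝ X)} (hv : v ∈ S)
    {u : Ω → X} (hu : u ∈ R) (hbot : integralFunctional μ f u ≠ ⊥)
    (htop : integralFunctional μ f u ≠ ⊤) (hsep : (sepAlmostRange μ u).Nonempty) :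
    v ∈ integralSubdifferential μ R S f u ↔ v ∈ ⋂ W ∈ sepAlmostRange μ u,
      {v' | v' ∈ S ∧ IntegrallyAE μ (fun ω => IsSubgradientOn (f ω) W (u ω) (v' ω))} := by
  rw [h.mem_integralSubdifferential_iff_isSubgradientOn hv hu hbot htop]
  simp only [mem_iInter, mem_ofPred_eq]
  constructor
  · intro h1 W hW
    exact ⟨hv, fun A hA => h1 A hA W hW.1 (hW.2 A hA)⟩
  · intro h1 A hA W hW huW
    obtain ⟨W₀, hW₀, huW₀⟩ := hsep
    have h2 := (h1 (W ∪ W₀) ⟨hW.union hW₀, fun B hB => (huW₀ B hB).mono fun ω h => .inr h⟩).2 A hA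
    filter_upwards [h2, huW] with ω h3 h4
    exact ⟨h4, h3.2.1, h3.2.2.1, fun x hx => h3.2.2.2 x (.inl hx)⟩

/-! ### Interchange of conjugation and integration -/

variable [CompleteSpace X] {R : Set (Ω → X)}

theorem IsPaired.le_conjOn_univ_of_isConjEssSup (h : IsPaired μ R f v)
    (hdom : ∃ u ∈ R, integralFunctional μ f u ≠ ⊤) {A : Set Ω} (hA : IsAtomSigmaFinite μ A)
    {α : Ω → EReal} (hα : IsConjEssSup μ f v A α) :
    ∀ᵐ ω ∂(μ.restrict A), α ω ≤ conjOn (f ω) univ (v ω) := by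
  obtain ⟨W, -, hαW⟩ := h.exists_isSeparable_eq hdom hA hα
  filter_upwards [hαW] with ω h1
  exact h1.trans_le (conjOn_mono (subset_univ W) _)

theorem IsPaired.conjugateUnderIntegral_of_integrallyDualizable (h : IsPaired μ R f v)
    (hdom : ∃ u ∈ R, integralFunctional μ f u ≠ ⊤) (hdual : IntegrallyDualizable μ f v) :
    ConjugateUnderIntegral μ R f v := by
  choose! α hα using fun A hA => h.exists_isConjEssSup hdom (A := A) hA
  have heq : ∀ A, IsAtomSigmaFinite μ A →
      ∀ᵐ ω ∂(μ.restrict A), α A ω = conjOn (f ω) univ (v ω) := fun A hA => by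
    obtain ⟨W, hW, hfW⟩ := hdual A hA
    filter_upwards [hfW, (hα A hA).conjOn_le hW,
      h.le_conjOn_univ_of_isConjEssSup hdom hA (hα A hA)] with ω h1 h2 h3
    exact le_antisymm h3 (h1.trans_le h2)
  refine ⟨fun A hA => (hα A hA).1.congr (heq A hA), ?_⟩
  rw [h.integralConjugate_eq hdom hα]
  exact exhIntegralFamily_congr heq

theorem IsPaired.integrallyDualizable_of_conjugateUnderIntegral (h : IsPaired μ R f v)
    (hdom : ∃ u ∈ R, integralFunctional μ f u ≠ ⊤) (hfin : integralConjugate μ R f v ≠ ⊤)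
    (hconj : ConjugateUnderIntegral μ R f v) : IntegrallyDualizable μ f v := by
  choose! α hα using fun A hA => h.exists_isConjEssSup hdom (A := A) hA
  have hcα := h.isConsistent_of_isConjEssSup hdom hα
  have hcF : IsConsistent μ fun _ ω => conjOn (f ω) univ (v ω) := isConsistent_const hconj.1
  have hbot : integralConjugate μ R f v ≠ ⊥ := by
    obtain ⟨u, hu, hfu⟩ := hdom
    exact ne_bot_of_le_ne_bot (h.exhIntegral_fenchelTerm_ne_bot hu hfu)
      (h.exhIntegral_fenchelTerm_le hu hfu)
  have hα' := h.integralConjugate_eq hdom hα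
  have hF := exhIntegralFamily_eq_add_exhPos_sub hcF hcα
    (fun A hA => h.le_conjOn_univ_of_isConjEssSup hdom hA (hα A hA)) (hα' ▸ hbot) (hα' ▸ hfin)
  have hF' := hconj.2
  rw [exhIntegral, hF, ← hα'] at hF'
  have h0 : exhPos μ (fun A ω => conjOn (f ω) univ (v ω) - α A ω) = 0 := by
    lift integralConjugate μ R f v to ℝ using ⟨hfin, hbot⟩ with r
    exact coe_add_coe_ennreal_le_iff.1 hF'.ge
  intro A hA
  obtain ⟨W, hW, hαW⟩ := h.exists_isSeparable_eq hdom hA (hα A hA)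
  refine ⟨W, hW, ?_⟩
  filter_upwards [ae_nonpos_of_exhPos_eq_zero (hcF.sub hcα) h0 hA, hαW] with ω h1 h2
  exact le_antisymm ((EReal.sub_nonpos.1 h1).trans_eq h2) (conjOn_mono (subset_univ W) _)

/-- A single separable set suffices: the excess of `f*(·, v)` over `⟨v, u⟩ - f(·, u)` is
concentrated on one countable union of atoms and sets of finite measure, and outside of it the
almost range of `u` is large enough. -/
theorem IsPaired.dualizableIAE_of_integrallyDualizable (h : IsPaired μ R f v)
    (hdom : ∃ u ∈ R, integralFunctional μ f u ≠ ⊤) (hfin : integralConjugate μ R f v ≠ ⊤)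
    (hsep : ∀ u ∈ R, (sepAlmostRange μ u).Nonempty) (hdual : IntegrallyDualizable μ f v) :
    DualizableIAE μ f v := by
  obtain ⟨hFm, hF⟩ := h.conjugateUnderIntegral_of_integrallyDualizable hdom hdual
  have hcF : IsConsistent μ fun _ ω => conjOn (f ω) univ (v ω) := isConsistent_const hFm
  obtain ⟨u, hu, hfu⟩ := hdom
  have hcu := h.isConsistent_fenchelTerm hu
  have hrb := h.exhIntegral_fenchelTerm_ne_bot hu hfu
  have hrt : exhIntegral μ (fenchelTerm f v u) ≠ ⊤ :=
    ne_top_of_le_ne_top hfin (h.exhIntegral_fenchelTerm_le hu hfu)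
  have hadd := exhIntegralFamily_eq_add_exhPos_sub hcF hcu
    (fun A _ => ae_of_all _ fun ω => fenchelTerm_le_conjOn (mem_univ _)) hrb hrt
  have hD : exhPos μ (fun _ ω => conjOn (f ω) univ (v ω) - fenchelTerm f v u ω) ≠ ⊤ := by
    intro htop
    rw [htop] at hadd
    refine hfin (hF.trans (hadd.trans ?_))
    exact EReal.add_top_of_ne_bot hrb
  obtain ⟨A₀, hA₀, hzero⟩ := exists_ae_eq_zero_of_exhLIntegral_ne_top
    (fun A hA => ((hcF.sub hcu).1 A hA).ereal_toENNReal) hD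
  obtain ⟨W₁, hW₁, hfW₁⟩ := hdual A₀ hA₀
  obtain ⟨W₂, hW₂, huW₂⟩ := hsep u hu
  refine ⟨W₁ ∪ W₂, hW₁.union hW₂, fun A hA => ?_⟩
  filter_upwards [hzero A hA, huW₂ A hA,
    ae_restrict_of_ae ((ae_restrict_iff' hA₀.measurableSet).1 hfW₁)] with ω h1 h2 h3
  refine le_antisymm ?_ (conjOn_mono (subset_univ _) _)
  by_cases hω : ω ∈ A₀
  · exact (h3 hω).trans_le (conjOn_mono subset_union_left _)
  · exact (EReal.sub_nonpos.1 (EReal.toENNReal_eq_zero_iff.1 (h1 hω))).trans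
      (fenchelTerm_le_conjOn (.inr h2))

theorem DualizableIAE.integrallyDualizable {Ω X : Type*} [MeasurableSpace Ω]
    [NormedAddCommGroup X] [NormedSpace ℝ X] {μ : Measure Ω} {f : Ω → X → EReal}
    {v : Ω → StrongDual ℝ X} (h : DualizableIAE μ f v) : IntegrallyDualizable μ f v := by
  obtain ⟨W, hW, hfW⟩ := h
  exact fun A hA => ⟨W, hW, hfW A hA⟩

theorem IsPaired.mem_integralSubdifferential_iff_of_integrallyDualizable
    (h : IsPaired μ R f v) {S : Set (Ω → StrongDual ℝ X)} (hv : v ∈ S) {u : Ω → X} (hu : u ∈ R)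
    (hbot : integralFunctional μ f u ≠ ⊥) (htop : integralFunctional μ f u ≠ ⊤)
    (hdual : IntegrallyDualizable μ f v) :
    v ∈ integralSubdifferential μ R S f u ↔
      IntegrallyAE μ (fun ω => IsSubgradientOn (f ω) univ (u ω) (v ω)) := by
  rw [h.mem_integralSubdifferential_iff hv hu hbot htop]
  constructor
  · intro h1 A hA
    obtain ⟨W, hW, hfW⟩ := hdual A hA
    filter_upwards [h1 A hA W hW, hfW, h.ae_integrand_real hu hbot htop hA] with ω h2 h3 h4
    exact (isSubgradientOn_iff h4.1 h4.2).2 ⟨mem_univ _, h3.trans_le h2⟩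
  · intro h1 A hA W hW
    filter_upwards [h1 A hA] with ω h2
    exact (conjOn_mono (subset_univ W) _).trans (conjOn_le_of_isSubgradientOn h2)

end Paired

end ConvexIntegral

theorem mainTheorem5 {Ω X : Type*} [MeasurableSpace Ω] [NormedAddCommGroup X] [NormedSpace ℝ X]
    [CompleteSpace X] [MeasurableSpace X] [BorelSpace X] (μ : Measure Ω)
    (R : Submodule ℝ (Ω → X)) (S : Submodule ℝ (Ω → StrongDual ℝ X))
    (hR : ∀ u ∈ R, ConvexIntegral.IntegrallyStronglyMeasurable μ u)
    (hRdec : ConvexIntegral.AlmostDecomposable μ (R : Set (Ω → X)))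
    (hS : ∀ v ∈ S, ConvexIntegral.IntegrallyWeakStarMeasurable μ v)
    (hpair : ∀ u ∈ R, ∀ v ∈ S,
      ConvexIntegral.pairing μ u v ≠ ⊥ ∧ ConvexIntegral.pairing μ u v ≠ ⊤)
    (f : Ω → X → EReal) (hf : ConvexIntegral.IntegrallySeparablyMeasurable μ f)
    (hdom : ∃ u ∈ R, ConvexIntegral.integralFunctional μ f u ≠ ⊤)
    (v : Ω → StrongDual ℝ X) (hv : v ∈ S)
    (hatom : ∀ A : Set Ω, ConvexIntegral.IsMeasureAtom μ A → μ A = ⊤ →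
      ∀ W : Set X, TopologicalSpace.IsSeparable W →
        ∀ᵐ ω ∂(μ.restrict A), ConvexIntegral.conjOn (f ω) W (v ω) ≤ 0) :
    -- representation of the conjugate by the exhausting integral of the essential suprema
    ((∀ A : Set Ω, ConvexIntegral.IsAtomSigmaFinite μ A → ∃ α : Ω → EReal,
        ConvexIntegral.IsEssSup (μ.restrict A)
          (fun (W : {W : Set X // TopologicalSpace.IsSeparable W}) ω =>
            ConvexIntegral.conjOn (f ω) W.1 (v ω)) α) ∧
      ∀ α : Set Ω → Ω → EReal,
        (∀ A : Set Ω, ConvexIntegral.IsAtomSigmaFinite μ A →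
          ConvexIntegral.IsEssSup (μ.restrict A)
            (fun (W : {W : Set X // TopologicalSpace.IsSeparable W}) ω =>
              ConvexIntegral.conjOn (f ω) W.1 (v ω)) (α A)) →
        ConvexIntegral.integralConjugate μ R f v = ConvexIntegral.exhIntegralFamily μ α) ∧
    -- the subdifferential at points where the functional is finite
    (∀ u ∈ R, ConvexIntegral.integralFunctional μ f u ≠ ⊥ →
      ConvexIntegral.integralFunctional μ f u ≠ ⊤ →
      (v ∈ ConvexIntegral.integralSubdifferential μ R S f u ↔
        ∀ A : Set Ω, ConvexIntegral.IsAtomSigmaFinite μ A →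
          ∀ W : Set X, TopologicalSpace.IsSeparable W → (∀ᵐ ω ∂(μ.restrict A), u ω ∈ W) →
            ∀ᵐ ω ∂(μ.restrict A), ConvexIntegral.IsSubgradientOn (f ω) W (u ω) (v ω)) ∧
      ((ConvexIntegral.sepAlmostRange μ u).Nonempty →
        (v ∈ ConvexIntegral.integralSubdifferential μ R S f u ↔
          v ∈ ⋂ W ∈ ConvexIntegral.sepAlmostRange μ u,
            {v' | v' ∈ S ∧ ConvexIntegral.IntegrallyAE μ
              (fun ω => ConvexIntegral.IsSubgradientOn (f ω) W (u ω) (v' ω))}))) ∧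
    -- interchange of conjugation and integration at points of the domain of the conjugate
    (ConvexIntegral.integralConjugate μ R f v ≠ ⊤ →
      (ConvexIntegral.ConjugateUnderIntegral μ R f v ↔
        ConvexIntegral.IntegrallyDualizable μ f v) ∧
      ((∀ u ∈ R, (ConvexIntegral.sepAlmostRange μ u).Nonempty) →
        (ConvexIntegral.ConjugateUnderIntegral μ R f v ↔
          ConvexIntegral.DualizableIAE μ f v)) ∧
      (ConvexIntegral.ConjugateUnderIntegral μ R f v ∨
          ConvexIntegral.IntegrallyDualizable μ f v →
        ∀ u ∈ R, ConvexIntegral.integralFunctional μ f u ≠ ⊥ →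
          ConvexIntegral.integralFunctional μ f u ≠ ⊤ →
          (v ∈ ConvexIntegral.integralSubdifferential μ R S f u ↔
            ConvexIntegral.IntegrallyAE μ
              (fun ω => ConvexIntegral.IsSubgradientOn (f ω) univ (u ω) (v ω))))) := by
  have h : ConvexIntegral.IsPaired μ (R : Set (Ω → X)) f v :=
    ⟨hR, hRdec, hS v hv, fun u hu => hpair u hu v hv, hf, hatom⟩
  refine ⟨⟨fun A hA => h.exists_isConjEssSup hdom hA, fun α hα => h.integralConjugate_eq hdom hα⟩,
    fun u hu hbot htop => ⟨h.mem_integralSubdifferential_iff_isSubgradientOn hv hu hbot htop,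
      fun hsep => h.mem_integralSubdifferential_iff_of_mem_sepAlmostRange hv hu hbot htop hsep⟩,
    fun hfin => ?_⟩
  have hiff : ConvexIntegral.ConjugateUnderIntegral μ R f v ↔
      ConvexIntegral.IntegrallyDualizable μ f v :=
    ⟨h.integrallyDualizable_of_conjugateUnderIntegral hdom hfin,
      h.conjugateUnderIntegral_of_integrallyDualizable hdom⟩
  refine ⟨hiff, fun hsep => hiff.trans
    ⟨h.dualizableIAE_of_integrallyDualizable hdom hfin hsep, fun hd => hd.integrallyDualizable⟩,
    fun hor u hu hbot htop => ?_⟩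
  exact h.mem_integralSubdifferential_iff_of_integrallyDualizable hv hu hbot htop
    (hor.elim hiff.1 id)
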